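/- \textbf{Conventions.} Let $p$ be a prime, $\mathbb{F}=\mathbb{F}_p$, $\mathbb{E}_{x}=\frac1p\sum_{x\in\mathbb{F}}$, $e(t)=e^{2\pi i t}$, $e_p(x)=e(x/p)$, $\langle f,g\rangle=\mathbb{E}_x f(x)\overline{g(x)}$ and $\|f\|_q=(\mathbb{E}_x|f(x)|^q)^{1/q}$. Every character $\chi$ of the multiplicative group $\mathbb{F}^*$ is extended to $\mathbb{F}$ by $\chi(0)=1$. For $f:\mathbb{F}\to\mathbb{C}$ let $$\|f\|_{\mathrm{QM}}=\sup\{|\langle f,\phi\chi\rangle| : \phi(x)=e_p(ax^2+bx),\ a,b\in\mathbb{F},\ \chi\in\widehat{\mathbb{F}^*}\}.$$ Let $\mathbb{G}=\mathbb{R}/\mathbb{Z}\times\mathbb{R}/\mathbb{Z}\times S^1$. For $(\theta_1,\theta_2,z)\in\mathbb{G}$ put $|(\theta_1,\theta_2,z)|=\max\{\|\theta_1\|_{\mathbb{R}/\mathbb{Z}},\|\theta_2\|_{\mathbb{R}/\mathbb{Z}},\|\frac{1}{2\pi i}\log z\|_{\mathbb{R}/\mathbb{Z}}\}$, where $\|\cdot\|_{\mathbb{R}/\mathbb{Z}}$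 is the distance to the nearest integer, and on $\mathbb{G}^d$ put $|(g_1,\dots,g_d)|=\max_i|g_i|$ (this is $0$ if $d=0$). For an integer $d\ge 0$, a \emph{QM-system of dimension $d$} is a map $\Psi:\mathbb{F}\to\mathbb{G}^d$ of the form $\Psi(x)=(a_ix^2/p,\,2a_ix/p,\,\psi_i(x))_{i=1}^d$ with $a_i\in\mathbb{F}$ and $\psi_i\in\widehat{\mathbb{F}^*}$. A QM-system $\Psi'$ of dimension $d'$ \emph{extends} $\Psi$, written $\Psi'\supset\Psi$, if $d'\ge d$ and $\Psi$ is $\Psi'$ followed by the projection $\mathbb{G}^{d'}\to\mathbb{G}^d$ to the first $d$ coordinates. The \emph{QM-Bohr set} of width $\delta$ is $B(\Psi,\delta)=\{x\in\mathbb{F}:|\Psi(x)|\le\delta\}$. For $F:\mathbb{G}^d\to\mathbb{C}$ let $\|F\|_{\mathrm{trig}}$ be the smallest $M\in[0,\infty]$ such that $$F(\theta_1,\theta_2,z)=\sum_{\|\xi_1\|_1,\|\xi_2\|_1,\|\xi_3\|_1\le M}\hat F(\xi_1,\xi_2,\xi_3)\,e(\xi_1\cdot\theta_1+\xi_2\cdot\theta_2)\,z^{\xi_3},\qquad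 \sum_{\xi_1,\xi_2,\xi_3}|\hat F(\xi_1,\xi_2,\xi_3)|\le M,$$ where $\xi_1,\xi_2,\xi_3$ range over $\mathbb{Z}^d$ (and $\|F\|_{\mathrm{trig}}=\infty$ if $F$ is not a finite linear combination of characters). A function of several variables, with values in $\mathbb{R}_{\ge1}$, $\mathbb{Z}_{\ge0}$ or $\mathbb{N}=\{1,2,\dots\}$, is called \emph{monotonic} if it is non-increasing in each variable that ranges over $(0,1]$ and non-decreasing in each of its other variables. \textbf{Proposition (regularity lemma).} Let $\Omega:\mathbb{Z}_{\ge0}\times\mathbb{Z}_{\ge0}\times(0,1]\times\mathbb{R}_{\ge0}\times\mathbb{Z}_{\ge0}\to\mathbb{R}_{\ge1}$ be monotonic. Then there are monotonic functions $M_\Omega$, $D_\Omega$, $p_\Omega$ from $\mathbb{Z}_{\ge0}\times\mathbb{Z}_{\ge0}\times(0,1]\times(0,1]$ to $\mathbb{R}_{\ge1}$, $\mathbb{Z}_{\ge0}$ and $\mathbb{N}$ respectively such that the following holds. Let $r,d\ge0$ be integers, let $\delta,\varepsilon\in(0,1]$, and let $p\ge p_\Omega(r,d,\delta,\varepsilon)$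 be a prime. Let $\Psi$ be a QM-system of dimension $d$, let $B=B(\Psi,\delta)$, let $\tilde B\subset B$ satisfy $|\tilde B|\ge(1-\frac{\varepsilon^2}{100})|B|$, and let $c:\tilde B\to\{1,\dots,r\}$ be an $r$-colouring. Then there are a QM-system $\Psi'\supset\Psi$ of some dimension $d'$, functions $F_1,\dots,F_r:\mathbb{G}^{d'}\to\mathbb{R}_{\ge0}$ and functions $g_1,\dots,g_r:\mathbb{F}\to[-1,1]$ such that \begin{enumerate} \item $\|F_i\|_{\mathrm{trig}}\le M_\Omega(r,d,\delta,\varepsilon)$ for all $i$; \item $d'\le D_\Omega(r,d,\delta,\varepsilon)$; \item $\|F_i\circ\Psi'-g_i\|_2\le\varepsilon$ for all $i$; \item $\|1_{c^{-1}(i)}-g_i\|_{\mathrm{QM}}\le 1/\Omega(r,d,\delta,\|F_i\|_{\mathrm{trig}},d')$ for all $i$; \item $\sum_{i=1}^rF_i(\Psi'(x))\ge1$ for every $x\in B(\Psi,\frac{\delta}{2})$; \item $\|F_i\circ\Psi'\|_4\le2$ for all $i$. \end{enumerate} -/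

import Mathlib

open scoped NNReal ENNReal

namespace QM

noncomputable section

/-- The half-open interval `(0,1]`. -/
abbrev I01 : Type := Set.Ioc (0 : ℝ) 1

/-- The half-line of real numbers that are at least `1`. -/
abbrev RGeOne : Type := Set.Ici (1 : ℝ)

/-- Monotonicity of a growth function `Ω(r, d, δ, M, d')`: it does not decrease when any of the
arguments `r, d, M, d'` increases or `δ` decreases. -/
def MonotoneGrowth (Ω : ℕ → ℕ → I01 → ℝ≥0 → ℕ → RGeOne) : Prop :=
  ∀ (r₁ r₂ d₁ d₂ : ℕ) (δ₁ δ₂ : I01) (M₁ M₂ : ℝ≥0) (e₁ e₂ : ℕ),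
    r₁ ≤ r₂ → d₁ ≤ d₂ → δ₂ ≤ δ₁ → M₁ ≤ M₂ → e₁ ≤ e₂ →
      Ω r₁ d₁ δ₁ M₁ e₁ ≤ Ω r₂ d₂ δ₂ M₂ e₂

/-- Monotonicity of a function `f(r, d, δ, ε)`: it does not decrease when `r` or `d` increases, or
when `δ` or `ε` decreases. -/
def MonotoneParam {β : Type} [LE β] (f : ℕ → ℕ → I01 → I01 → β) : Prop :=
  ∀ (r₁ r₂ d₁ d₂ : ℕ) (δ₁ δ₂ ε₁ ε₂ : I01),
    r₁ ≤ r₂ → d₁ ≤ d₂ → δ₂ ≤ δ₁ → ε₂ ≤ ε₁ → f r₁ d₁ δ₁ ε₁ ≤ f r₂ d₂ δ₂ ε₂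

/-- The group `ℝ/ℤ × ℝ/ℤ × S¹`. -/
abbrev G : Type := UnitAddCircle × UnitAddCircle × Circle

/-- The power `G^d`. -/
abbrev Gd (d : ℕ) : Type := Fin d → G

/-- The distance from `(log z) / (2πi)` to the nearest integer, for `z` on the unit circle. -/
def circleAbs (z : Circle) : ℝ :=
  ‖((Complex.arg (z : ℂ) / (2 * Real.pi) : ℝ) : UnitAddCircle)‖

/-- `|(θ₁, θ₂, z)|`. The norm of `UnitAddCircle` is the distance to the nearest integer. -/
def absG (g : G) : ℝ := max (max ‖g.1‖ ‖g.2.1‖) (circleAbs g.2.2)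

/-- `|(g₁, …, g_d)| = max_i |g_i|` (which is `0` for `d = 0`). -/
def absGd {d : ℕ} (g : Gd d) : ℝ := ⨆ i, absG (g i)

/-- A multiplicative character of `𝔽_p`, extended by `χ(0) = 1`. -/
def extChar {p : ℕ} [Fact p.Prime] (χ : (ZMod p)ˣ →* Circle) (x : ZMod p) : Circle :=
  if h : x = 0 then 1 else χ (Units.mk0 x h)

/-- `Ψ` is a QM-system of dimension `d`: it has the form
`Ψ(x) = (a_i x² / p, 2 a_i x / p, ψ_i(x))_{i ≤ d}`. Here `ZMod.toAddCircle` is `x ↦ x / p mod 1`. -/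
def IsQMSystem {p : ℕ} [Fact p.Prime] {d : ℕ} (Ψ : ZMod p → Gd d) : Prop :=
  ∃ (a : Fin d → ZMod p) (ψ : Fin d → ((ZMod p)ˣ →* Circle)), ∀ x i,
    Ψ x i = (ZMod.toAddCircle (a i * x ^ 2), ZMod.toAddCircle (2 * a i * x), extChar (ψ i) x)

/-- `Ψ' ⊃ Ψ`: the dimension of `Ψ'` is at least that of `Ψ`, and `Ψ` is `Ψ'` followed by the
projection to the first `d` coordinates. -/
def Extends {p d d' : ℕ} (Ψ' : ZMod p → Gd d') (Ψ : ZMod p → Gd d) : Prop :=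
  ∃ h : d ≤ d', ∀ x i, Ψ x i = Ψ' x (Fin.castLE h i)

/-- The QM-Bohr set `B(Ψ, ε) = {x : |Ψ(x)| ≤ ε}`. -/
def bohrSet {p d : ℕ} (Ψ : ZMod p → Gd d) (ε : ℝ) : Set (ZMod p) := {x | absGd (Ψ x) ≤ ε}

/-- The normalised inner product `𝔼_x f(x) conj(g(x))`. -/
def innerAvg {p : ℕ} [Fact p.Prime] (f g : ZMod p → ℂ) : ℂ :=
  (∑ x, f x * (starRingEnd ℂ) (g x)) / p

/-- The normalised norm `‖f‖_q = (𝔼_x |f(x)|^q)^{1/q}` of a real function. -/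
def avgNorm {p : ℕ} [Fact p.Prime] (q : ℕ) (f : ZMod p → ℝ) : ℝ :=
  ((∑ x, |f x| ^ q) / p) ^ (1 / (q : ℝ))

/-- The quadratic phases `x ↦ e_p(r x² + s x)`. Here `ZMod.stdAddChar` is `e_p`. -/
def quadPhases (p : ℕ) [Fact p.Prime] : Set (ZMod p → ℂ) :=
  {φ | ∃ r s : ZMod p, ∀ x, φ x = ZMod.stdAddChar (r * x ^ 2 + s * x)}

/-- The QM-norm: the largest correlation of `f` with the product of a quadratic phase and an
extended multiplicative character. -/
def qmNorm {p : ℕ} [Fact p.Prime] (f : ZMod p → ℂ) : ℝ :=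
  sSup {t | ∃ φ ∈ quadPhases p, ∃ χ : (ZMod p)ˣ →* Circle,
    t = ‖innerAvg f (fun x => φ x * (extChar χ x : ℂ))‖}

/-- Frequencies `(ξ₁, ξ₂, ξ₃)` of characters of `G^d`. -/
abbrev Freq (d : ℕ) : Type := (Fin d → ℤ) × (Fin d → ℤ) × (Fin d → ℤ)

/-- The `ℓ¹`-norm of an integer vector. -/
def l1 {d : ℕ} (ξ : Fin d → ℤ) : ℕ := ∑ j, (ξ j).natAbs

/-- The character `e(ξ₁ · θ₁ + ξ₂ · θ₂) z^{ξ₃}` of `G^d`. Here `AddCircle.toCircle` is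
`θ ↦ e(θ) = exp(2πiθ)`. -/
def gdChar {d : ℕ} (ξ : Freq d) (g : Gd d) : ℂ :=
  (AddCircle.toCircle (∑ j, ξ.1 j • (g j).1 + ∑ j, ξ.2.1 j • (g j).2.1) : ℂ) *
    ∏ j, ((g j).2.2 : ℂ) ^ (ξ.2.2 j)

/-- The trig norm of `F`: the smallest `M` in `[0, ∞]` such that `F` has a Fourier expansion that
uses only frequencies with `‖ξ₁‖₁, ‖ξ₂‖₁, ‖ξ₃‖₁ ≤ M` and whose coefficients have absolute sum at most
`M`; it is `∞` when there is no finite expansion. -/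
def trigNorm {d : ℕ} (F : Gd d → ℂ) : ℝ≥0∞ :=
  sInf {M | ∃ a : Freq d →₀ ℂ,
    (∀ g, F g = ∑ ξ ∈ a.support, a ξ * gdChar ξ g) ∧
    (∀ ξ ∈ a.support, (l1 ξ.1 : ℝ≥0∞) ≤ M ∧ (l1 ξ.2.1 : ℝ≥0∞) ≤ M ∧ (l1 ξ.2.2 : ℝ≥0∞) ≤ M) ∧
    ∑ ξ ∈ a.support, ‖a ξ‖ₑ ≤ M}

/-- The colour class `c⁻¹(i)`, as a subset of `𝔽_p`. -/
def colourClass {p r : ℕ} {Bt : Set (ZMod p)} (c : Bt → Fin r) (i : Fin r) : Set (ZMod p) :=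
  Subtype.val '' (c ⁻¹' {i})

end

end QM

namespace QM

noncomputable section

/-! ### Averages and energies over soft partitions -/

section FinitePartition

variable {X ι κ : Type*} [Fintype ι] [Fintype κ]

/-! The proof is an energy increment with continuous partitions of unity in place of sigma-algebras.
Start on `Gd d` with `{W, 1 - W}`, where `W` is a cutoff adapted to the Bohr set. Given a partition
pulled back along a system, take the phase that correlates almost best with some `f i - smooth u (f
i)`, `f i` being the indicator of a colour class. Two new coordinates make this phase a fixed
continuous function on the larger group; refining by its approximate level sets turns any remaining
correlation into an energy increase (`exists_extension_qmNorm_le`, iterated in `exists_chain`).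

The normalised energy is at most `r`, so a double pigeonhole (`exists_stable_pair`) yields stages `t
≤ t'`, bounded independently of `p`: the energy hardly changes from `t` to `t'`, and the step after
`t'` gains very little compared with the complexity at stage `t`. Then `g i` is the average of `f i`
at stage `t'`, and `F i` is a trigonometric majorant of the average at stage `t` plus a correction.
The correction fills the deficit of the colour densities below `W`; it is small in mean square
because `B \ Bt` is small (`deficit_mul_le`).

The partitions live on `Gd (d + 2 * t)` and do not see `p` or the colouring, so Stone–Weierstrass
(`Cells.exists_trig_approx`) bounds the trig norm at each stage uniformly. Rounding `δ` and `ε` to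
integer parameters and summing over boxes gives monotone bounds. -/

/-- A finite family of nonnegative functions on `X` with sum `1`. -/
structure IsPartition (u : ι → X → ℝ) : Prop where
  nonneg : ∀ k x, 0 ≤ u k x
  sum_one : ∀ x, ∑ k, u k x = 1

/-- `v` refines `u`: every cell of `u` is the sum of the cells of `v` assigned to it. -/
def Refines (v : κ → X → ℝ) (u : ι → X → ℝ) : Prop :=
  ∃ π : κ → ι, ∀ (h : ι → ℝ) x, ∑ k, h k * u k x = ∑ l, h (π l) * v l x

theorem Refines.refl (u : ι → X → ℝ) : Refines u u := ⟨id, fun _ _ => rfl⟩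

theorem Refines.trans {ρ : Type*} [Fintype ρ] {w : ρ → X → ℝ} {v : κ → X → ℝ} {u : ι → X → ℝ}
    (h₁ : Refines w v) (h₂ : Refines v u) : Refines w u := by
  obtain ⟨π₁, h₁⟩ := h₁
  obtain ⟨π₂, h₂⟩ := h₂
  exact ⟨π₂ ∘ π₁, fun h x => (h₂ h x).trans (h₁ (h ∘ π₂) x)⟩

variable {u : ι → X → ℝ} {v : κ → X → ℝ} {f g : X → ℝ}

theorem sum_mul_sq_le (hu : IsPartition u) (a : ι → ℝ) (x : X) :
    (∑ k, a k * u k x) ^ 2 ≤ ∑ k, a k ^ 2 * u k x := by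
  have h := Finset.sum_sq_le_sum_mul_sum_of_sq_le_mul Finset.univ (r := fun k => a k * u k x)
    (f := fun k => a k ^ 2 * u k x) (g := fun k => u k x)
    (fun k _ => mul_nonneg (sq_nonneg _) (hu.nonneg k x)) (fun k _ => hu.nonneg k x)
    (fun k _ => (by ring : _ = _).le)
  rwa [hu.sum_one, mul_one] at h

variable [Fintype X]

/-- The mean of `f` with respect to the weight `u k`. -/
def cellMean (u : ι → X → ℝ) (f : X → ℝ) (k : ι) : ℝ := (∑ x, f x * u k x) / ∑ x, u k x

/-- The energy of `f` relative to the partition `u`. -/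
def cellEnergy (u : ι → X → ℝ) (f : X → ℝ) : ℝ := ∑ k, (∑ x, u k x) * cellMean u f k ^ 2

/-- The average of `f` over the cells of the partition `u`. -/
def smooth (u : ι → X → ℝ) (f : X → ℝ) (x : X) : ℝ := ∑ k, cellMean u f k * u k x

/-- A cell of mass zero vanishes identically, so the value `0` given by division by zero is
harmless. -/
theorem mass_mul_cellMean (hu : IsPartition u) (f : X → ℝ) (k : ι) :
    (∑ x, u k x) * cellMean u f k = ∑ x, f x * u k x := by
  unfold cellMean
  by_cases h : ∑ x, u k x = 0
  · have h0 := (Finset.sum_eq_zero_iff_of_nonneg (fun x _ => hu.nonneg k x)).1 h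
    rw [h, zero_mul, Finset.sum_eq_zero]
    intro x hx
    rw [h0 x hx, mul_zero]
  · field_simp

theorem cellMean_nonneg (hu : IsPartition u) (hf : ∀ x, 0 ≤ f x) (k : ι) : 0 ≤ cellMean u f k :=
  div_nonneg (Finset.sum_nonneg fun x _ => mul_nonneg (hf x) (hu.nonneg k x))
    (Finset.sum_nonneg fun x _ => hu.nonneg k x)

theorem cellMean_le_one (hu : IsPartition u) (hf : ∀ x, f x ≤ 1) (k : ι) : cellMean u f k ≤ 1 :=
  div_le_one_of_le₀
    (Finset.sum_le_sum fun x _ => mul_le_of_le_one_left (hu.nonneg k x) (hf x))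
    (Finset.sum_nonneg fun x _ => hu.nonneg k x)

theorem sum_sum_mul_comm (a : ι → ℝ) (u : ι → X → ℝ) :
    ∑ x, ∑ k, a k * u k x = ∑ k, (∑ x, u k x) * a k := by
  rw [Finset.sum_comm]
  refine Finset.sum_congr rfl fun k _ => ?_
  rw [Finset.sum_mul]
  exact Finset.sum_congr rfl fun x _ => mul_comm _ _

theorem sum_mul_smooth (hu : IsPartition u) (f : X → ℝ) :
    ∑ x, f x * smooth u f x = cellEnergy u f := by
  unfold smooth cellEnergy
  simp_rw [Finset.mul_sum]
  rw [Finset.sum_comm]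
  refine Finset.sum_congr rfl fun k _ => ?_
  rw [sq, ← mul_assoc, mass_mul_cellMean hu, Finset.sum_mul]
  exact Finset.sum_congr rfl fun x _ => by ring

/-- A substitute for Pythagoras. Smoothing over overlapping cells is not a projection, but Jensen in
each point bounds the left side by the mass-weighted squared differences of cell means, and that
quantity is exactly the energy increment. -/
theorem sum_smooth_sub_sq_le (hu : IsPartition u) (hv : IsPartition v) (h : Refines v u)
    (f : X → ℝ) :
    ∑ x, (smooth v f x - smooth u f x) ^ 2 ≤ cellEnergy v f - cellEnergy u f := by
  obtain ⟨π, h⟩ := h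
  have h₁ : ∀ x, smooth v f x - smooth u f x
      = ∑ l, (cellMean v f l - cellMean u f (π l)) * v l x := fun x => by
    simp only [sub_mul, Finset.sum_sub_distrib, ← h]
    rfl
  have h₂ : ∑ x, f x * smooth u f x = ∑ l, cellMean u f (π l) * ((∑ x, v l x) * cellMean v f l) := by
    simp only [mass_mul_cellMean hv, smooth, h, Finset.mul_sum]
    rw [Finset.sum_comm]
    exact Finset.sum_congr rfl fun k _ => Finset.sum_congr rfl fun x _ => by ring
  have h₃ : cellEnergy u f = ∑ l, (∑ x, v l x) * cellMean u f (π l) ^ 2 := by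
    rw [cellEnergy, ← sum_sum_mul_comm, ← sum_sum_mul_comm]
    exact Finset.sum_congr rfl fun x _ => h _ x
  rw [sum_mul_smooth hu] at h₂
  calc ∑ x, (smooth v f x - smooth u f x) ^ 2
      ≤ ∑ x, ∑ l, (cellMean v f l - cellMean u f (π l)) ^ 2 * v l x :=
        Finset.sum_le_sum fun x _ => by rw [h₁]; exact sum_mul_sq_le hv _ x
    _ = cellEnergy v f - 2 * cellEnergy u f + cellEnergy u f := by
        rw [sum_sum_mul_comm]
        nth_rw 1 [h₂]
        rw [h₃, cellEnergy, Finset.mul_sum, ← Finset.sum_sub_distrib, ← Finset.sum_add_distrib]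
        exact Finset.sum_congr rfl fun l _ => by ring
    _ = _ := by ring

theorem cellEnergy_mono (hu : IsPartition u) (hv : IsPartition v) (h : Refines v u)
    (f : X → ℝ) : cellEnergy u f ≤ cellEnergy v f :=
  sub_nonneg.1 ((Finset.sum_nonneg fun _ _ => sq_nonneg _).trans (sum_smooth_sub_sq_le hu hv h f))

theorem cellEnergy_nonneg (hu : IsPartition u) (f : X → ℝ) : 0 ≤ cellEnergy u f :=
  Finset.sum_nonneg fun k _ => mul_nonneg (Finset.sum_nonneg fun x _ => hu.nonneg k x) (sq_nonneg _)

theorem sum_smooth_sq_le_cellEnergy (hu : IsPartition u) (f : X → ℝ) :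
    ∑ x, smooth u f x ^ 2 ≤ cellEnergy u f := by
  rw [cellEnergy, ← sum_sum_mul_comm]
  exact Finset.sum_le_sum fun x _ => sum_mul_sq_le hu _ x

theorem cellEnergy_le (hu : IsPartition u) (f : X → ℝ) : cellEnergy u f ≤ ∑ x, f x ^ 2 := by
  have h : 0 ≤ ∑ x, (f x - smooth u f x) ^ 2 := Finset.sum_nonneg fun _ _ => sq_nonneg _
  have h₂ : ∑ x, (f x - smooth u f x) ^ 2
      = ∑ x, f x ^ 2 - 2 * ∑ x, f x * smooth u f x + ∑ x, smooth u f x ^ 2 := by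
    rw [Finset.mul_sum, ← Finset.sum_sub_distrib, ← Finset.sum_add_distrib]
    exact Finset.sum_congr rfl fun l _ => by ring
  rw [sum_mul_smooth hu] at h₂
  linarith [sum_smooth_sq_le_cellEnergy hu f]

theorem smooth_nonneg (hu : IsPartition u) (hf : ∀ x, 0 ≤ f x) (x : X) : 0 ≤ smooth u f x :=
  Finset.sum_nonneg fun k _ => mul_nonneg (cellMean_nonneg hu hf k) (hu.nonneg k x)

theorem smooth_le_one (hu : IsPartition u) (hf : ∀ x, f x ≤ 1) (x : X) : smooth u f x ≤ 1 := by
  rw [← hu.sum_one x]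
  exact Finset.sum_le_sum fun k _ =>
    mul_le_of_le_one_left (hu.nonneg k x) (cellMean_le_one hu hf k)

/-- The function `(f - cellMean u f k) * u k` has sum zero for each `k`, so `φ` may be replaced by
`φ - b k` on that cell. -/
theorem norm_sum_sub_smooth_mul_le (hu : IsPartition u) (hf₀ : ∀ x, 0 ≤ f x) (hf₁ : ∀ x, f x ≤ 1)
    {φ : X → ℂ} {b : ι → ℂ} {η : ℝ} (hφ : ∀ k x, u k x ≠ 0 → ‖φ x - b k‖ ≤ η) :
    ‖∑ x, ((f x - smooth u f x : ℝ) : ℂ) * φ x‖ ≤ η * Fintype.card X := by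
  have h₁ : ∑ x, ((f x - smooth u f x : ℝ) : ℂ) * φ x
      = ∑ x, ∑ k, (((f x - cellMean u f k) * u k x : ℝ) : ℂ) * (φ x - b k) := by
    have h₂ : ∀ x, f x - smooth u f x = ∑ k, (f x - cellMean u f k) * u k x := fun x => by
      simp only [sub_mul, Finset.sum_sub_distrib, ← Finset.mul_sum, hu.sum_one, mul_one]
      rfl
    have h₃ : ∑ x, ∑ k, (((f x - cellMean u f k) * u k x : ℝ) : ℂ) * b k = 0 := by
      rw [Finset.sum_comm]
      refine Finset.sum_eq_zero fun k _ => ?_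
      rw [← Finset.sum_mul, ← Complex.ofReal_sum]
      simp only [sub_mul, Finset.sum_sub_distrib, ← Finset.mul_sum]
      rw [mul_comm, ← mass_mul_cellMean hu, mul_comm (cellMean u f k), sub_self]
      simp
    simp only [mul_sub, Finset.sum_sub_distrib, h₃, sub_zero]
    refine Finset.sum_congr rfl fun x _ => ?_
    rw [h₂, Complex.ofReal_sum, Finset.sum_mul]
  rw [h₁]
  calc _ ≤ ∑ x : X, η := by
        refine (norm_sum_le _ _).trans (Finset.sum_le_sum fun x _ => ?_)
        calc _ ≤ ∑ k, u k x * η := by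
              refine (norm_sum_le _ _).trans (Finset.sum_le_sum fun k _ => ?_)
              by_cases h0 : u k x = 0
              · simp [h0]
              · rw [norm_mul, Complex.norm_real, norm_mul, Real.norm_eq_abs, Real.norm_eq_abs,
                  abs_of_nonneg (hu.nonneg k x)]
                have h4 : |f x - cellMean u f k| ≤ 1 := by
                  rw [abs_le]
                  constructor <;>
                  linarith [hf₀ x, hf₁ x, cellMean_nonneg hu hf₀ k, cellMean_le_one hu hf₁ k]
                exact mul_le_mul (mul_le_of_le_one_left (hu.nonneg k x) h4) (hφ k x h0)
                  (norm_nonneg _) (hu.nonneg k x)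
          _ = η := by rw [← Finset.sum_mul, hu.sum_one, one_mul]
    _ = _ := by simp [mul_comm]

theorem norm_sum_mul_le_sqrt {φ : X → ℂ} (hφ : ∀ x, ‖φ x‖ ≤ 1) (g : X → ℝ) :
    ‖∑ x, (g x : ℂ) * φ x‖ ≤ √(Fintype.card X * ∑ x, g x ^ 2) := by
  apply Real.le_sqrt_of_sq_le
  have h₁ : ‖∑ x, (g x : ℂ) * φ x‖ ≤ ∑ x, |g x| :=
    (norm_sum_le _ _).trans (Finset.sum_le_sum fun x _ => by
      rw [norm_mul, Complex.norm_real]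
      exact mul_le_of_le_one_right (norm_nonneg _) (hφ x))
  calc _ ≤ (∑ x, |g x|) ^ 2 := by gcongr
    _ ≤ _ := by simpa using sq_sum_le_card_mul_sum_sq (s := Finset.univ) (f := fun x => |g x|)

/-- Correlation forces an energy increment: pass through `smooth v f`, against which `φ` is nearly
constant on cells, and control the change of averages by Cauchy–Schwarz. -/
theorem norm_sum_sub_smooth_mul_le_of_refines (hu : IsPartition u) (hv : IsPartition v)
    (h : Refines v u) (hf₀ : ∀ x, 0 ≤ f x) (hf₁ : ∀ x, f x ≤ 1)
    {φ : X → ℂ} (hφ₁ : ∀ x, ‖φ x‖ ≤ 1) {b : κ → ℂ} {η : ℝ}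
    (hφ : ∀ k x, v k x ≠ 0 → ‖φ x - b k‖ ≤ η) :
    ‖∑ x, ((f x - smooth u f x : ℝ) : ℂ) * φ x‖
      ≤ η * Fintype.card X + √(Fintype.card X * (cellEnergy v f - cellEnergy u f)) := by
  have h₁ : ∑ x, ((f x - smooth u f x : ℝ) : ℂ) * φ x
      = ∑ x, ((f x - smooth v f x : ℝ) : ℂ) * φ x
        + ∑ x, ((smooth v f x - smooth u f x : ℝ) : ℂ) * φ x := by
    rw [← Finset.sum_add_distrib]
    exact Finset.sum_congr rfl fun x _ => by push_cast; ring
  rw [h₁]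
  refine (norm_add_le _ _).trans (add_le_add (norm_sum_sub_smooth_mul_le hv hf₀ hf₁ hφ)
    ((norm_sum_mul_le_sqrt hφ₁ _).trans (Real.sqrt_le_sqrt ?_)))
  exact mul_le_mul_of_nonneg_left (sum_smooth_sub_sq_le hu hv h f) (Nat.cast_nonneg _)

end FinitePartition

/-! ### Pigeonholing bounded monotone sequences -/

section Sequences

theorem exists_small_step {E : ℕ → ℝ} {R κ : ℝ} (h₀ : ∀ t, 0 ≤ E t) (hR : ∀ t, E t ≤ R) {J : ℕ}
    (hJ : R < J * κ) : ∃ j < J, E (j + 1) - E j ≤ κ := by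
  by_contra! h
  have h₁ : ∑ j ∈ Finset.range J, κ ≤ ∑ j ∈ Finset.range J, (E (j + 1) - E j) :=
    Finset.sum_le_sum fun j hj => (h j (Finset.mem_range.1 hj)).le
  rw [Finset.sum_range_sub] at h₁
  simp only [Finset.sum_const, Finset.card_range, nsmul_eq_mul] at h₁
  linarith [h₀ 0, hR J]

/-- A coarse pigeonhole over blocks finds one with gain at most `κ`; a second one inside that block
finds a cheap single step. `T` is chosen before `E`, which makes the final bounds uniform in `p` and
the colouring. -/
theorem exists_stable_pair (R : ℝ) {κ : ℝ} (hκ : 0 < κ) {τ : ℕ → ℝ} (hτ : ∀ t, 0 < τ t) :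
    ∃ T : ℕ, ∀ E : ℕ → ℝ, Monotone E → (∀ t, 0 ≤ E t) → (∀ t, E t ≤ R) →
      ∃ t t', t ≤ t' ∧ t' ≤ T ∧ E t' - E t ≤ κ ∧ E (t' + 1) - E t' ≤ τ t ^ 2 ∧
        1 / ((t' : ℝ) + 1) ≤ τ t := by
  have hN : ∀ t, ∃ N : ℕ, 1 / ((N : ℝ) + 1) < τ t := fun t => exists_nat_one_div_lt (hτ t)
  choose N hN using hN
  have hL : ∀ t, ∃ L : ℕ, R < L * τ t ^ 2 := fun t => by
    obtain ⟨L, hL⟩ := exists_nat_gt (R / τ t ^ 2)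
    exact ⟨L, (div_lt_iff₀ (pow_pos (hτ t) 2)).1 hL⟩
  choose L hL using hL
  obtain ⟨J, hJ⟩ := exists_nat_gt (R / κ)
  rw [div_lt_iff₀ hκ] at hJ
  -- Block `j` starts at `s j`: the first `N` steps make the mesh `1 / (t' + 1)` small, the next `L`
  -- leave room for the inner pigeonhole.
  let s : ℕ → ℕ := fun j => Nat.rec 0 (fun _ t => t + N t + L t) j
  have hs : ∀ j, s (j + 1) = s j + N (s j) + L (s j) := fun _ => rfl
  have hs_mono : Monotone s := monotone_nat_of_le_succ fun j => by rw [hs]; omega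
  refine ⟨s J, fun E hE h₀ hR => ?_⟩
  obtain ⟨j, hj, hj'⟩ := exists_small_step (E := E ∘ s) (fun t => h₀ _) (fun t => hR _) hJ
  obtain ⟨i, hi, hi'⟩ := exists_small_step (E := fun i => E (s j + N (s j) + i))
    (fun t => h₀ _) (fun t => hR _) (hL (s j))
  have h₁ : s j + N (s j) + i ≤ s (j + 1) := by rw [hs]; omega
  refine ⟨s j, s j + N (s j) + i, by omega, h₁.trans (hs_mono hj), ?_, hi', ?_⟩
  · exact (sub_le_sub_right (hE h₁) _).trans hj'
  · refine le_trans ?_ (hN (s j)).le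
    apply one_div_le_one_div_of_le (by positivity)
    have : N (s j) ≤ s j + N (s j) + i := by omega
    exact_mod_cast Nat.succ_le_succ this

end Sequences
-- Trigonometric polynomials and Stone–Weierstrass
section Trig

variable {n : ℕ}

/-- `F` has a finite Fourier expansion whose frequencies and total coefficient size are at most
`M`. -/
def HasTrigBound (F : Gd n → ℂ) (M : ℝ≥0∞) : Prop :=
  ∃ a : Freq n →₀ ℂ,
    (∀ g, F g = ∑ ξ ∈ a.support, a ξ * gdChar ξ g) ∧
    (∀ ξ ∈ a.support, (l1 ξ.1 : ℝ≥0∞) ≤ M ∧ (l1 ξ.2.1 : ℝ≥0∞) ≤ M ∧ (l1 ξ.2.2 : ℝ≥0∞) ≤ M) ∧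
    ∑ ξ ∈ a.support, ‖a ξ‖ₑ ≤ M

theorem HasTrigBound.trigNorm_le {F : Gd n → ℂ} {M : ℝ≥0∞} (h : HasTrigBound F M) :
    trigNorm F ≤ M := sInf_le h

theorem HasTrigBound.zero (M : ℝ≥0∞) : HasTrigBound (fun _ : Gd n => 0) M :=
  ⟨0, by simp, by simp, by simp⟩

theorem HasTrigBound.add {F H : Gd n → ℂ} {M N : ℝ≥0∞} (hF : HasTrigBound F M)
    (hH : HasTrigBound H N) : HasTrigBound (fun y => F y + H y) (M + N) := by
  classical
  obtain ⟨a, h₁, h₂, h₃⟩ := hF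
  obtain ⟨b, k₁, k₂, k₃⟩ := hH
  have ha : a.support ⊆ a.support ∪ b.support := Finset.subset_union_left
  have hb : b.support ⊆ a.support ∪ b.support := Finset.subset_union_right
  have hab : (a + b).support ⊆ a.support ∪ b.support := Finsupp.support_add
  have key : ∀ {R : Type} [AddCommMonoid R] (c : Freq n →₀ ℂ) (g : Freq n → ℂ → R),
      (∀ ξ, g ξ 0 = 0) → c.support ⊆ a.support ∪ b.support →
      ∑ ξ ∈ c.support, g ξ (c ξ) = ∑ ξ ∈ a.support ∪ b.support, g ξ (c ξ) :=
    fun c g hg hc => Finset.sum_subset hc fun ξ _ hξ => by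
      rw [Finsupp.notMem_support_iff.1 hξ, hg]
  refine ⟨a + b, fun y => ?_, fun ξ hξ => ?_, ?_⟩
  · beta_reduce
    rw [h₁, k₁, key a (fun ξ z => z * gdChar ξ y) (by simp) ha,
      key b (fun ξ z => z * gdChar ξ y) (by simp) hb,
      key (a + b) (fun ξ z => z * gdChar ξ y) (by simp) hab, ← Finset.sum_add_distrib]
    exact Finset.sum_congr rfl fun ξ _ => by rw [Finsupp.add_apply, add_mul]
  · rcases Finset.mem_union.1 (hab hξ) with h | h
    · obtain ⟨i, j, k⟩ := h₂ ξ h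
      exact ⟨i.trans le_self_add, j.trans le_self_add, k.trans le_self_add⟩
    · obtain ⟨i, j, k⟩ := k₂ ξ h
      exact ⟨i.trans le_add_self, j.trans le_add_self, k.trans le_add_self⟩
  · refine le_trans ?_ (add_le_add h₃ k₃)
    rw [key a (fun _ z => ‖z‖ₑ) (by simp) ha, key b (fun _ z => ‖z‖ₑ) (by simp) hb,
      key (a + b) (fun _ z => ‖z‖ₑ) (by simp) hab, ← Finset.sum_add_distrib]
    exact Finset.sum_le_sum fun ξ _ => enorm_add_le _ _

theorem HasTrigBound.const_mul {F : Gd n → ℂ} {M N : ℝ≥0∞} (hF : HasTrigBound F M) {c : ℂ}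
    (hc : ‖c‖ₑ ≤ N) (hN : 1 ≤ N) : HasTrigBound (fun y => c * F y) (N * M) := by
  obtain ⟨a, h₁, h₂, h₃⟩ := hF
  have hM : M ≤ N * M := le_mul_of_one_le_left (by simp) hN
  have hs : (c • a).support ⊆ a.support := Finsupp.support_smul
  refine ⟨c • a, fun y => ?_, fun ξ hξ => ?_, ?_⟩
  · beta_reduce
    rw [h₁, Finset.mul_sum]
    symm
    rw [Finset.sum_subset hs fun ξ _ hξ => by rw [Finsupp.notMem_support_iff.1 hξ, zero_mul]]
    exact Finset.sum_congr rfl fun ξ _ => by rw [Finsupp.smul_apply, smul_eq_mul, mul_assoc]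
  · obtain ⟨i, j, k⟩ := h₂ ξ (hs hξ)
    exact ⟨i.trans hM, j.trans hM, k.trans hM⟩
  · calc ∑ ξ ∈ (c • a).support, ‖(c • a) ξ‖ₑ ≤ ∑ ξ ∈ a.support, ‖(c • a) ξ‖ₑ :=
          Finset.sum_le_sum_of_subset hs
      _ = ‖c‖ₑ * ∑ ξ ∈ a.support, ‖a ξ‖ₑ := by
          rw [Finset.mul_sum]
          exact Finset.sum_congr rfl fun ξ _ => by rw [Finsupp.smul_apply, smul_eq_mul, enorm_mul]
      _ ≤ _ := by gcongr

theorem HasTrigBound.sum {ι : Type*} (s : Finset ι) {F : ι → Gd n → ℂ} {M : ι → ℝ≥0∞}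
    (hF : ∀ k ∈ s, HasTrigBound (F k) (M k)) :
    HasTrigBound (fun y => ∑ k ∈ s, F k y) (∑ k ∈ s, M k) := by
  classical
  induction s using Finset.induction_on with
  | empty => simpa using HasTrigBound.zero 0
  | insert k s hk ih =>
    simp only [Finset.sum_insert hk]
    exact (hF k (Finset.mem_insert_self _ _)).add
      (ih fun j hj => hF j (Finset.mem_insert_of_mem hj))

theorem HasTrigBound.gdChar (ξ : Freq n) :
    HasTrigBound (QM.gdChar ξ) ((l1 ξ.1 + l1 ξ.2.1 + l1 ξ.2.2 + 1 : ℕ) : ℝ≥0∞) := by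
  have hs : (Finsupp.single ξ (1 : ℂ)).support = {ξ} :=
    by simp [Finsupp.support_single]
  refine ⟨Finsupp.single ξ 1, fun g => by simp, fun ζ hζ => ?_, ?_⟩
  · rw [hs, Finset.mem_singleton] at hζ
    subst hζ
    exact ⟨by gcongr; omega, by gcongr; omega, by gcongr; omega⟩
  · rw [hs, Finset.sum_singleton, Finsupp.single_eq_same]
    simp

theorem gdChar_zero (y : Gd n) : gdChar 0 y = 1 := by simp [gdChar]

theorem gdChar_add (ξ ζ : Freq n) (y : Gd n) :
    gdChar (ξ + ζ) y = gdChar ξ y * gdChar ζ y := by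
  have hz : ∀ z : Circle, (z : ℂ) ≠ 0 := fun z => Circle.coe_ne_zero z
  simp only [gdChar, Prod.fst_add, Prod.snd_add, Pi.add_apply, add_smul, Finset.sum_add_distrib,
    AddCircle.toCircle_add, Circle.coe_mul, zpow_add₀ (hz _), Finset.prod_mul_distrib]
  ring

theorem gdChar_neg (ξ : Freq n) (y : Gd n) :
    gdChar (-ξ) y = (starRingEnd ℂ) (gdChar ξ y) := by
  simp only [gdChar, Prod.fst_neg, Prod.snd_neg, Pi.neg_apply, neg_smul, Finset.sum_neg_distrib,
    ← neg_add, AddCircle.toCircle_neg, Circle.coe_inv_eq_conj, map_mul, map_prod, zpow_neg,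
    map_zpow₀, ← inv_zpow, ← Circle.coe_inv]

theorem continuous_gdChar (ξ : Freq n) : Continuous (gdChar ξ) := by
  unfold gdChar
  have hz : ∀ z : Circle, (z : ℂ) ≠ 0 := fun z => Circle.coe_ne_zero z
  refine Continuous.mul ?_ ?_
  · refine continuous_subtype_val.comp (AddCircle.continuous_toCircle.comp ?_)
    fun_prop
  · refine continuous_finsetProd _ fun j _ => ?_
    exact (continuous_subtype_val.comp (by fun_prop)).zpow₀ _ fun y => Or.inl (hz _)

/-- The character `gdChar ξ` as a continuous function. -/
def gdCharC (ξ : Freq n) : C(Gd n, ℂ) := ⟨gdChar ξ, continuous_gdChar ξ⟩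

/-- The trigonometric polynomials on `G^n`. -/
def trigSubalgebra (n : ℕ) : StarSubalgebra ℂ C(Gd n, ℂ) where
  toSubalgebra := Algebra.adjoin ℂ (Set.range gdCharC)
  star_mem' := by
    change Algebra.adjoin ℂ (Set.range gdCharC) ≤ star (Algebra.adjoin ℂ (Set.range gdCharC))
    refine Algebra.adjoin_le ?_
    rintro _ ⟨ξ, rfl⟩
    refine Algebra.subset_adjoin ⟨-ξ, ?_⟩
    ext1 y
    exact gdChar_neg ξ y

/-- Characters are closed under products, so the generated algebra is only a linear span; this
permits induction on linear combinations. -/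
theorem trigSubalgebra_coe (n : ℕ) :
    (trigSubalgebra n).toSubalgebra.toSubmodule = Submodule.span ℂ (Set.range gdCharC) := by
  apply Algebra.adjoin_eq_span_of_subset
  refine .trans (fun x => Submonoid.closure_induction (fun _ => id) ⟨0, ?_⟩ ?_)
    Submodule.subset_span
  · ext y
    exact gdChar_zero y
  · rintro _ _ _ _ ⟨ξ, rfl⟩ ⟨ζ, rfl⟩
    refine ⟨ξ + ζ, ?_⟩
    ext y
    exact gdChar_add ξ ζ y

theorem trigSubalgebra_separatesPoints (n : ℕ) :
    (trigSubalgebra n).toSubalgebra.SeparatesPoints := by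
  classical
  intro x y hxy
  obtain ⟨i, hi⟩ := Function.ne_iff.1 hxy
  have key : ∀ ξ : Freq n, gdChar ξ x ≠ gdChar ξ y →
      ∃ f ∈ (fun f : C(Gd n, ℂ) => (f : Gd n → ℂ)) '' ((trigSubalgebra n).toSubalgebra : Set _),
        f x ≠ f y :=
    fun ξ h => ⟨_, ⟨gdCharC ξ, Algebra.subset_adjoin ⟨ξ, rfl⟩, rfl⟩, h⟩
  by_contra h
  have key' : ∀ ξ : Freq n, gdChar ξ x = gdChar ξ y := fun ξ => by
    by_contra h'
    exact h (key ξ h')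
  refine hi (Prod.ext ?_ (Prod.ext ?_ ?_))
  · have h₁ := key' (Pi.single i 1, 0, 0)
    simp only [gdChar, Pi.single_apply, ite_smul, one_smul, zero_smul, Finset.sum_ite_eq',
      Finset.mem_univ, if_true, Pi.zero_apply, Finset.sum_const_zero, add_zero, zpow_zero,
      Finset.prod_const_one, mul_one] at h₁
    exact AddCircle.injective_toCircle one_ne_zero (Circle.coe_injective h₁)
  · have h₁ := key' (0, Pi.single i 1, 0)
    simp only [gdChar, Pi.single_apply, ite_smul, one_smul, zero_smul, Finset.sum_ite_eq',
      Finset.mem_univ, if_true, Pi.zero_apply, Finset.sum_const_zero, zero_add, zpow_zero,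
      Finset.prod_const_one, mul_one] at h₁
    exact AddCircle.injective_toCircle one_ne_zero (Circle.coe_injective h₁)
  · have h₁ := key' (0, 0, Pi.single i 1)
    simp only [gdChar, Pi.single_apply, zero_smul, Pi.zero_apply, Finset.sum_const_zero, zero_add,
      AddCircle.toCircle_zero, Circle.coe_one, one_mul] at h₁
    have h₂ : ∀ z : Gd n, ∏ j, ((z j).2.2 : ℂ) ^ (if j = i then (1 : ℤ) else 0) = (z i).2.2 :=
      fun z => by
        rw [Finset.prod_eq_single i] <;> simp +contextual
    rw [h₂, h₂] at h₁
    exact Circle.coe_injective h₁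

theorem exists_hasTrigBound_of_mem {f : C(Gd n, ℂ)} (hf : f ∈ trigSubalgebra n) :
    ∃ M : ℝ≥0, HasTrigBound f M := by
  replace hf : f ∈ (trigSubalgebra n).toSubalgebra.toSubmodule := hf
  rw [trigSubalgebra_coe] at hf
  induction hf using Submodule.span_induction with
  | mem f h =>
    obtain ⟨ξ, rfl⟩ := h
    exact ⟨(l1 ξ.1 + l1 ξ.2.1 + l1 ξ.2.2 + 1 : ℕ), by
      rw [ENNReal.coe_natCast]; exact HasTrigBound.gdChar ξ⟩
  | zero => exact ⟨0, HasTrigBound.zero _⟩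
  | add f g _ _ h₁ h₂ =>
    obtain ⟨M, hM⟩ := h₁
    obtain ⟨N, hN⟩ := h₂
    exact ⟨M + N, by rw [ENNReal.coe_add]; exact hM.add hN⟩
  | smul c f _ h₁ =>
    obtain ⟨M, hM⟩ := h₁
    refine ⟨(1 + ‖c‖₊) * M, ?_⟩
    rw [ENNReal.coe_mul]
    refine hM.const_mul ?_ ?_
    · rw [enorm_eq_nnnorm]; exact_mod_cast le_add_self
    · exact_mod_cast le_self_add

/-- Real continuous functions on `G^n` are uniform limits of real trigonometric polynomials. -/
theorem exists_trig_approx (f : C(Gd n, ℝ)) {η : ℝ} (hη : 0 < η) :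
    ∃ (P : Gd n → ℝ) (M : ℝ≥0), HasTrigBound (fun y => (P y : ℂ)) M ∧ ∀ y, |P y - f y| ≤ η := by
  let fc : C(Gd n, ℂ) := ⟨fun y => (f y : ℂ), Complex.continuous_ofReal.comp f.continuous⟩
  have hmem : fc ∈ closure (trigSubalgebra n : Set C(Gd n, ℂ)) := by
    rw [← StarSubalgebra.topologicalClosure_coe,
      ContinuousMap.starSubalgebra_topologicalClosure_eq_top_of_separatesPoints _
        (trigSubalgebra_separatesPoints n)]
    trivial
  obtain ⟨q, hq, hdist⟩ := Metric.mem_closure_iff.1 hmem η hη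
  -- The real part is `(q + star q) / 2`, again a trigonometric polynomial.
  obtain ⟨M, hM⟩ := exists_hasTrigBound_of_mem
    ((trigSubalgebra n).smul_mem (add_mem hq (star_mem hq)) (2⁻¹ : ℂ))
  refine ⟨fun y => (q y).re, M, ?_, fun y => ?_⟩
  · convert hM using 2 with y
    simp only [ContinuousMap.smul_apply, ContinuousMap.add_apply, ContinuousMap.star_apply,
      smul_eq_mul]
    rw [← starRingEnd_apply, Complex.add_conj]
    push_cast
    ring
  · have h₁ := (ContinuousMap.dist_apply_le_dist (f := fc) (g := q) y).trans hdist.le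
    rw [dist_comm, dist_eq_norm] at h₁
    refine le_trans ?_ h₁
    have h₂ := Complex.abs_re_le_norm (q y - fc y)
    simpa [fc] using h₂

end Trig

/-! ### Continuous partitions of unity -/

section Cells

/-- A finite continuous partition of unity. -/
structure Cells (Y : Type) [TopologicalSpace Y] where
  ι : Type
  [fintype : Fintype ι]
  u : ι → C(Y, ℝ)
  nonneg : ∀ k y, 0 ≤ u k y
  sum_one : ∀ y, ∑ k, u k y = 1

attribute [instance] Cells.fintype

variable {Y Z : Type} [TopologicalSpace Y] [TopologicalSpace Z]

/-- The pullback of a partition of unity under a continuous map. -/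
def Cells.comp (C : Cells Y) (f : C(Z, Y)) : Cells Z where
  ι := C.ι
  u k := (C.u k).comp f
  nonneg k z := C.nonneg k (f z)
  sum_one z := C.sum_one (f z)

/-- The common refinement of two partitions of unity. -/
def Cells.prod (C D : Cells Y) : Cells Y where
  ι := C.ι × D.ι
  u k := C.u k.1 * D.u k.2
  nonneg k y := mul_nonneg (C.nonneg _ y) (D.nonneg _ y)
  sum_one y := by
    simp only [ContinuousMap.mul_apply, Fintype.sum_prod_type, ← Finset.mul_sum, D.sum_one,
      mul_one, C.sum_one]

/-- The partition `{f, 1 - f}`. -/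
def Cells.ofFun (f : C(Y, ℝ)) (h₀ : ∀ y, 0 ≤ f y) (h₁ : ∀ y, f y ≤ 1) : Cells Y where
  ι := Bool
  u b := if b then f else 1 - f
  nonneg b y := by cases b <;> simp [h₀, h₁]
  sum_one y := by simp

/-- The family of functions on `X` obtained by pulling back a partition of unity. -/
def Cells.pull {X : Type*} (C : Cells Y) (Ψ : X → Y) (k : C.ι) (x : X) : ℝ := C.u k (Ψ x)

theorem Cells.isPartition_pull {X : Type*} (C : Cells Y) (Ψ : X → Y) :
    IsPartition (C.pull Ψ) :=
  ⟨fun k x => C.nonneg k (Ψ x), fun x => C.sum_one (Ψ x)⟩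

/-- Normalised tent functions on a finite cover by `η`-balls. -/
theorem exists_circleCells {η : ℝ} (hη : 0 < η) :
    ∃ C : Cells Circle, ∃ b : C.ι → Circle, ∀ l z, C.u l z ≠ 0 → ‖(z : ℂ) - b l‖ ≤ η := by
  obtain ⟨s, -, hs, hcov⟩ := (isCompact_univ (X := Circle)).finite_cover_balls hη
  have : Fintype s := hs.fintype
  let w : s → Circle → ℝ := fun b z => max 0 (η - dist z b)
  have hw : ∀ b, Continuous (w b) := fun b => by fun_prop
  have hw₀ : ∀ b z, 0 ≤ w b z := fun b z => le_max_left _ _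
  have hpos : ∀ z, 0 < ∑ b, w b z := fun z => by
    have hz := hcov (Set.mem_univ z)
    simp only [Set.mem_iUnion, Metric.mem_ball, exists_prop] at hz
    obtain ⟨b, hb, hzb⟩ := hz
    exact Finset.sum_pos' (fun b _ => hw₀ b z)
      ⟨⟨b, hb⟩, Finset.mem_univ _, lt_max_of_lt_right (sub_pos.2 hzb)⟩
  refine ⟨⟨s, fun b => ⟨fun z => w b z / ∑ b, w b z,
    (hw b).div (continuous_finsetSum _ fun b _ => hw b) fun z => (hpos z).ne'⟩,
    fun b z => div_nonneg (hw₀ b z) (hpos z).le, fun z => ?_⟩, fun b => b, fun b z h => ?_⟩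
  · change ∑ k, w k z / ∑ b, w b z = 1
    rw [← Finset.sum_div, div_self (hpos z).ne']
  · by_contra! h'
    apply h
    have h₂ : w b z = 0 := max_eq_left (by
      have : dist z b = ‖(z : ℂ) - (b : Circle)‖ := by rw [← dist_eq_norm]; rfl
      linarith)
    change w b z / _ = 0
    rw [h₂, zero_div]

/-- Combinations of the cells with coefficients in `[0, 1]` have approximants with uniformly
bounded trig norm. -/
theorem Cells.exists_trig_approx {n : ℕ} (C : Cells (Gd n)) {η : ℝ} (hη : 0 < η) :
    ∃ M : ℝ≥0, ∀ a : C.ι → ℝ, (∀ k, 0 ≤ a k) → (∀ k, a k ≤ 1) →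
      ∃ F : Gd n → ℝ, trigNorm (fun y => (F y : ℂ)) ≤ M ∧
        ∀ y, ∑ k, a k * C.u k y ≤ F y ∧ F y ≤ ∑ k, a k * C.u k y + 2 * η := by
  have hc : (0 : ℝ) < Fintype.card C.ι + 1 := by positivity
  have h := fun k => QM.exists_trig_approx (C.u k) (div_pos hη hc)
  choose P M hM hP using h
  -- Adding the constant `η` turns a two-sided approximation into a majorant, so nonnegativity and
  -- lower bounds survive.
  refine ⟨∑ k, M k + (1 + ‖(η : ℂ)‖₊) * 1, fun a h₀ h₁ =>
    ⟨fun y => ∑ k, a k * P k y + η, ?_, fun y => ?_⟩⟩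
  · push_cast
    apply HasTrigBound.trigNorm_le
    refine HasTrigBound.add (HasTrigBound.sum _ fun k _ => ?_) ?_
    · have := (hM k).const_mul (c := (a k : ℂ)) (N := 1) (by
        rw [← ofReal_norm, Complex.norm_real, Real.norm_of_nonneg (h₀ k)]
        simpa using h₁ k) le_rfl
      rwa [one_mul] at this
    · have := (HasTrigBound.gdChar (0 : Freq n)).const_mul (c := (η : ℂ)) (N := 1 + ‖(η : ℂ)‖₊)
        (by rw [enorm_eq_nnnorm]; exact le_add_self) le_self_add
      simpa [gdChar_zero, l1] using this
  · have h₂ : |∑ k, a k * P k y - ∑ k, a k * C.u k y| ≤ η := by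
      rw [← Finset.sum_sub_distrib]
      calc _ ≤ ∑ k : C.ι, η / (Fintype.card C.ι + 1) := by
            refine (Finset.abs_sum_le_sum_abs _ _).trans (Finset.sum_le_sum fun k _ => ?_)
            rw [← mul_sub, abs_mul, abs_of_nonneg (h₀ k)]
            exact (mul_le_of_le_one_left (abs_nonneg _) (h₁ k)).trans (hP k y)
        _ ≤ η := by
            rw [Finset.sum_const, Finset.card_univ, nsmul_eq_mul, mul_div_assoc', div_le_iff₀ hc]
            nlinarith
    rw [abs_le] at h₂
    constructor <;> linarith

end Cells
-- A continuous cutoff for Bohr sets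
section Cutoff

/-- Gives continuity of `circleAbs`: the argument jumps at `-1`, but its absolute value does not. -/
theorem circleAbs_eq (z : Circle) : circleAbs z = Real.arccos (z : ℂ).re / (2 * Real.pi) := by
  have hpi := Real.pi_pos
  have harg := Complex.abs_arg_le_pi (z : ℂ)
  have h₁ : Real.arccos (z : ℂ).re = |Complex.arg (z : ℂ)| := by
    have h := Complex.norm_mul_cos_arg (z : ℂ)
    rw [Circle.norm_coe, one_mul] at h
    rw [← h, ← Real.cos_abs, Real.arccos_cos (abs_nonneg _) harg]
  have h₂ : |Complex.arg (z : ℂ) / (2 * Real.pi)| = |Complex.arg (z : ℂ)| / (2 * Real.pi) := by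
    rw [abs_div, abs_of_pos (by positivity : 0 < 2 * Real.pi)]
  rw [circleAbs, h₁, (AddCircle.norm_coe_eq_abs_iff 1 one_ne_zero).2, h₂]
  rw [h₂, abs_one, div_le_div_iff₀ (by positivity) two_pos]
  linarith

theorem continuous_absG : Continuous absG := by
  have h : circleAbs = fun z : Circle => Real.arccos (z : ℂ).re / (2 * Real.pi) :=
    funext circleAbs_eq
  unfold absG
  rw [h]
  have := Real.continuous_arccos
  fun_prop

theorem absG_le_of_absGd_le {d : ℕ} {y : Gd d} {δ : ℝ} (h : absGd y ≤ δ) (i : Fin d) :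
    absG (y i) ≤ δ :=
  (le_ciSup (Set.finite_range fun i => absG (y i)).bddAbove i).trans h

theorem exists_cutoff {a b : ℝ} (hab : a < b) (d : ℕ) :
    ∃ W : C(Gd d, ℝ), (∀ y, 0 ≤ W y) ∧ (∀ y, W y ≤ 1) ∧
      (∀ y, (∀ i, absG (y i) ≤ a) → W y = 1) ∧ ∀ y, W y ≠ 0 → ∀ i, absG (y i) ≤ b := by
  have hba : 0 < b - a := sub_pos.2 hab
  let ρ : ℝ → ℝ := fun s => max 0 (min 1 ((b - s) / (b - a)))
  have hρ : Continuous ρ := by fun_prop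
  have hρ₀ : ∀ s, 0 ≤ ρ s := fun s => le_max_left _ _
  have hρ₁ : ∀ s, ρ s ≤ 1 := fun s => max_le zero_le_one (min_le_left _ _)
  have hG := continuous_absG
  refine ⟨⟨fun y => ∏ i, ρ (absG (y i)), by fun_prop⟩,
    fun y => Finset.prod_nonneg fun i _ => hρ₀ _,
    fun y => Finset.prod_le_one (fun i _ => hρ₀ _) fun i _ => hρ₁ _,
    fun y hy => Finset.prod_eq_one fun i _ => ?_, fun y hy i => ?_⟩
  · have : 1 ≤ (b - absG (y i)) / (b - a) := by
      rw [le_div_iff₀ hba]; linarith [hy i]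
    simp [ρ, min_eq_left this]
  · by_contra! h
    refine hy (Finset.prod_eq_zero (Finset.mem_univ i) ?_)
    exact max_eq_left ((min_le_right _ _).trans
      (div_nonpos_of_nonpos_of_nonneg (by linarith) hba.le))

end Cutoff

/-! ### One step of the energy increment -/

section Stages

/-- The projection that forgets the last two coordinates. -/
def forgetTwo (n : ℕ) : C(Gd (n + 2), Gd n) := ⟨fun y i => y (i.castAdd 2), by fun_prop⟩

/-- The phase read off from the last two coordinates. -/
def lastPhase (n : ℕ) : C(Gd (n + 2), Circle) :=
  ⟨fun y => AddCircle.toCircle ((y (Fin.natAdd n 0)).1 + (y (Fin.natAdd n 1)).2.1) *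
    (y (Fin.natAdd n 0)).2.2, by
    refine Continuous.mul (AddCircle.continuous_toCircle.comp ?_) ?_ <;> fun_prop⟩

/-- The refinement of a partition of `G^n` by the level sets of the last phase on `G^(n+2)`. -/
def Cells.refine {n : ℕ} (C : Cells (Gd n)) (D : Cells Circle) : Cells (Gd (n + 2)) :=
  (C.comp (forgetTwo n)).prod (D.comp (lastPhase n))

/-- Iterated refinements of a partition of `G^d`. -/
def stages {d : ℕ} (C : Cells (Gd d)) (D : ℕ → Cells Circle) : ∀ t : ℕ, Cells (Gd (d + 2 * t))
  | 0 => C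
  | t + 1 => (stages C D t).refine (D t)

theorem Cells.refines_refine {n : ℕ} {X : Type*} (C : Cells (Gd n)) (D : Cells Circle)
    {Ψ : X → Gd n} {Ψ' : X → Gd (n + 2)} (h : ∀ x, forgetTwo n (Ψ' x) = Ψ x) :
    Refines ((C.refine D).pull Ψ') (C.pull Ψ) := by
  refine ⟨Prod.fst, fun g x => ?_⟩
  change _ = ∑ l : C.ι × D.ι, g l.1 * (C.u l.1 (forgetTwo n (Ψ' x)) * D.u l.2 (lastPhase n (Ψ' x)))
  rw [Fintype.sum_prod_type, h]
  simp only [← Finset.mul_sum, D.sum_one, mul_one]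
  rfl

variable {p : ℕ} [Fact p.Prime]

/-- The parameters `(r, χ)` and `(s / 2, 1)` supply `r x²`, `χ` and the linear term `2 (s / 2) x`.
Halving `s` is why `p` must be odd. -/
theorem exists_extension_with_phase (hp : 3 ≤ p) {n : ℕ} {Ψ : ZMod p → Gd n} (hΨ : IsQMSystem Ψ)
    {φ : ZMod p → ℂ} (hφ : φ ∈ quadPhases p) (χ : (ZMod p)ˣ →* Circle) :
    ∃ Ψ' : ZMod p → Gd (n + 2), IsQMSystem Ψ' ∧ (∀ x, forgetTwo n (Ψ' x) = Ψ x) ∧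
      ∀ x, (lastPhase n (Ψ' x) : ℂ) = φ x * extChar χ x := by
  obtain ⟨a, ψ, h⟩ := hΨ
  obtain ⟨r, s, hφ⟩ := hφ
  have h2 : (2 : ZMod p) ≠ 0 := by
    intro h0
    have h1 : ((2 : ℕ) : ZMod p) = 0 := by exact_mod_cast h0
    rw [ZMod.natCast_eq_zero_iff] at h1
    exact absurd (Nat.le_of_dvd two_pos h1) (by omega)
  let a' : Fin (n + 2) → ZMod p := Fin.append a ![r, s / 2]
  let ψ' : Fin (n + 2) → ((ZMod p)ˣ →* Circle) := Fin.append ψ ![χ, 1]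
  refine ⟨fun x i => (ZMod.toAddCircle (a' i * x ^ 2), ZMod.toAddCircle (2 * a' i * x),
    extChar (ψ' i) x), ⟨a', ψ', fun x i => rfl⟩, fun x => funext fun i => ?_, fun x => ?_⟩
  · rw [h]
    simp [forgetTwo, a', ψ']
  · have h₁ : 2 * (s / 2) * x = s * x := by field_simp
    have h₂ : a' (Fin.natAdd n 0) = r := by simp [a']
    have h₃ : a' (Fin.natAdd n 1) = s / 2 := by simp [a']
    have h₄ : ψ' (Fin.natAdd n 0) = χ := by simp [ψ']
    rw [hφ, ZMod.stdAddChar_apply]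
    change ((AddCircle.toCircle (ZMod.toAddCircle (a' (Fin.natAdd n 0) * x ^ 2)
      + ZMod.toAddCircle (2 * a' (Fin.natAdd n 1) * x)) * extChar (ψ' (Fin.natAdd n 0)) x : Circle) :
        ℂ) = _
    rw [h₂, h₃, h₄, h₁, ← map_add, Circle.coe_mul]
    rfl

theorem norm_innerAvg_sub_smooth_le {n r : ℕ} (C : Cells (Gd n)) {D : Cells Circle}
    {b : D.ι → Circle} {η : ℝ} (hD : ∀ l z, D.u l z ≠ 0 → ‖(z : ℂ) - b l‖ ≤ η)
    {Ψ : ZMod p → Gd n} {Ψ' : ZMod p → Gd (n + 2)} (h : ∀ x, forgetTwo n (Ψ' x) = Ψ x)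
    {f : Fin r → ZMod p → ℝ} (hf₀ : ∀ i x, 0 ≤ f i x) (hf₁ : ∀ i x, f i x ≤ 1) (i : Fin r) :
    ‖innerAvg (fun x => ((f i x - smooth (C.pull Ψ) (f i) x : ℝ) : ℂ))
        (fun x => (lastPhase n (Ψ' x) : ℂ))‖ ≤
      η + √((∑ i, cellEnergy ((C.refine D).pull Ψ') (f i)) / p
        - (∑ i, cellEnergy (C.pull Ψ) (f i)) / p) := by
  have hp : (0 : ℝ) < p := by exact_mod_cast (Fact.out : p.Prime).pos
  have hu := C.isPartition_pull Ψ
  have hv := (C.refine D).isPartition_pull Ψ'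
  have href := C.refines_refine D h
  have key := norm_sum_sub_smooth_mul_le_of_refines hu hv href (hf₀ i) (hf₁ i)
    (φ := fun x => (starRingEnd ℂ) (lastPhase n (Ψ' x) : ℂ))
    (fun x => by rw [RCLike.norm_conj, Circle.norm_coe])
    (b := fun k => (starRingEnd ℂ) (b k.2 : ℂ)) (η := η) (fun k x hk => by
      rw [← map_sub, RCLike.norm_conj]
      exact hD _ _ (right_ne_zero_of_mul hk))
  have hE : cellEnergy ((C.refine D).pull Ψ') (f i) - cellEnergy (C.pull Ψ) (f i)
      ≤ ∑ i, cellEnergy ((C.refine D).pull Ψ') (f i) - ∑ i, cellEnergy (C.pull Ψ) (f i) := by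
    rw [← Finset.sum_sub_distrib]
    exact Finset.single_le_sum (f := fun i => cellEnergy ((C.refine D).pull Ψ') (f i)
      - cellEnergy (C.pull Ψ) (f i))
      (fun j _ => sub_nonneg.2 (cellEnergy_mono hu hv href (f j))) (Finset.mem_univ i)
  rw [innerAvg, norm_div, Complex.norm_natCast, div_le_iff₀ hp]
  refine key.trans ?_
  rw [ZMod.card, ← sub_div]
  set S := ∑ i, cellEnergy ((C.refine D).pull Ψ') (f i) - ∑ i, cellEnergy (C.pull Ψ) (f i)
  have h₁ : √((p : ℝ) * S) = √(S / p) * p := by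
    rw [show (p : ℝ) * S = S / p * (p * p) by field_simp, Real.sqrt_mul' _ (by positivity),
      Real.sqrt_mul_self hp.le]
  rw [add_mul, ← h₁]
  gcongr

theorem exists_extension_qmNorm_le (hp : 3 ≤ p) {n r : ℕ} (hr : 0 < r) (C : Cells (Gd n))
    {D : Cells Circle} {b : D.ι → Circle} {η : ℝ} (hη : 0 < η)
    (hD : ∀ l z, D.u l z ≠ 0 → ‖(z : ℂ) - b l‖ ≤ η) {Ψ : ZMod p → Gd n} (hΨ : IsQMSystem Ψ)
    {f : Fin r → ZMod p → ℝ} (hf₀ : ∀ i x, 0 ≤ f i x) (hf₁ : ∀ i x, f i x ≤ 1) :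
    ∃ Ψ' : ZMod p → Gd (n + 2), IsQMSystem Ψ' ∧ (∀ x, forgetTwo n (Ψ' x) = Ψ x) ∧
      ∀ i, qmNorm (fun x => ((f i x - smooth (C.pull Ψ) (f i) x : ℝ) : ℂ)) ≤
        2 * η + √((∑ i, cellEnergy ((C.refine D).pull Ψ') (f i)) / p
          - (∑ i, cellEnergy (C.pull Ψ) (f i)) / p) := by
  have : Nonempty (Fin r) := ⟨⟨0, hr⟩⟩
  -- Only the colour with the largest norm needs a near-optimal phase; the total energy increment
  -- then bounds all colours at once.
  obtain ⟨i, hi⟩ := Finite.exists_max fun i : Fin r =>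
    qmNorm (fun x => ((f i x - smooth (C.pull Ψ) (f i) x : ℝ) : ℂ))
  have hne : {t | ∃ φ ∈ quadPhases p, ∃ χ : (ZMod p)ˣ →* Circle,
      t = ‖innerAvg (fun x => ((f i x - smooth (C.pull Ψ) (f i) x : ℝ) : ℂ))
        (fun x => φ x * (extChar χ x : ℂ))‖}.Nonempty :=
    ⟨_, _, ⟨0, 0, fun _ => rfl⟩, 1, rfl⟩
  obtain ⟨_, ⟨φ, hφ, χ, rfl⟩, hlt⟩ := exists_lt_of_lt_csSup hne (sub_lt_self _ hη)
  obtain ⟨Ψ', h₁, h₂, h₃⟩ := exists_extension_with_phase hp hΨ hφ χ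
  refine ⟨Ψ', h₁, h₂, fun j => (hi j).trans ?_⟩
  have h₄ := norm_innerAvg_sub_smooth_le C hD h₂ hf₀ hf₁ i
  simp only [h₃] at h₄
  change qmNorm _ - η < _ at hlt
  linarith

end Stages

/-! ### Repairing the lower bound on the sum of densities -/

section Correction

variable {X ι : Type*} [Fintype X] [Fintype ι] {r : ℕ}

/-- Averaging `1 ≤ ∑ i, f i + e` over a cell of positive mass shows that the mean of `e` covers what
the densities lack. -/
theorem deficit_mul_le {u : ι → X → ℝ} (hu : IsPartition u) {f : Fin r → X → ℝ} {w : ι → ℝ}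
    {e : X → ℝ} (he : ∀ x, 0 ≤ e x) (hf : ∀ i x, 0 ≤ f i x) {k : ι} (hw₁ : w k ≤ 1)
    (hw : w k ≤ 0 ∨ ∀ x, u k x ≠ 0 → 1 ≤ ∑ i, f i x + e x) (x : X) :
    max 0 (w k - ∑ i, cellMean u (f i) k) * u k x ≤ cellMean u e k * u k x := by
  by_cases hx : u k x = 0
  · simp [hx]
  refine mul_le_mul_of_nonneg_right (max_le (cellMean_nonneg hu he k) ?_) (hu.nonneg k x)
  have hs : 0 ≤ ∑ i, cellMean u (f i) k := Finset.sum_nonneg fun i _ => cellMean_nonneg hu (hf i) k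
  rcases hw with hw | hw
  · linarith [cellMean_nonneg hu he k]
  have hm : 0 < ∑ x, u k x := Finset.sum_pos' (fun x _ => hu.nonneg k x)
    ⟨x, Finset.mem_univ x, lt_of_le_of_ne (hu.nonneg k x) (Ne.symm hx)⟩
  have h₁ : (∑ x, u k x) * 1 ≤ (∑ x, u k x) * (∑ i, cellMean u (f i) k + cellMean u e k) := by
    rw [mul_add, Finset.mul_sum]
    simp only [mass_mul_cellMean hu]
    rw [Finset.sum_comm, ← Finset.sum_add_distrib, mul_one]
    refine Finset.sum_le_sum fun x _ => ?_
    rw [← Finset.sum_mul, ← add_mul]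
    by_cases hx : u k x = 0
    · simp [hx]
    · exact le_mul_of_one_le_left (hu.nonneg k x) (hw x hx)
  linarith [le_of_mul_le_mul_left h₁ hm]

theorem sum_indicator_one_sq (S : Set X) :
    ∑ x, (S.indicator (fun _ => (1 : ℝ)) x) ^ 2 = S.ncard := by
  classical
  simp [Set.indicator_apply, Set.ncard_eq_toFinset_card']

end Correction

theorem avgNorm_le {p q : ℕ} [Fact p.Prime] (hq : q ≠ 0) {f : ZMod p → ℝ} {c : ℝ} (hc : 0 ≤ c)
    (h : ∑ x, |f x| ^ q ≤ c ^ q * p) : avgNorm q f ≤ c := by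
  have hp : (0 : ℝ) < p := by exact_mod_cast (Fact.out : p.Prime).pos
  calc avgNorm q f ≤ (c ^ q) ^ (1 / (q : ℝ)) :=
        Real.rpow_le_rpow (by positivity) ((div_le_iff₀ hp).2 h) (by positivity)
    _ = c := by rw [one_div, Real.pow_rpow_inv_natCast hc hq]

/-! ### Iterating the extension -/

section Chains

theorem extends_chain {p d : ℕ} {Φ : ∀ t, ZMod p → Gd (d + 2 * t)}
    (h : ∀ t x, forgetTwo _ (Φ (t + 1) x) = Φ t x) (t : ℕ) : Extends (Φ t) (Φ 0) := by
  refine ⟨by omega, fun x i => ?_⟩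
  induction t with
  | zero => rfl
  | succ t ih =>
    rw [ih, ← h t x]
    rfl

theorem refines_chain {p d : ℕ} (C : Cells (Gd d)) (D : ℕ → Cells Circle)
    {Φ : ∀ t, ZMod p → Gd (d + 2 * t)}
    (h : ∀ t x, forgetTwo _ (Φ (t + 1) x) = Φ t x) {s t : ℕ} (hst : s ≤ t) :
    Refines ((stages C D t).pull (Φ t)) ((stages C D s).pull (Φ s)) := by
  induction t, hst using Nat.le_induction with
  | base => exact Refines.refl _
  | succ t _ ih => exact ((stages C D t).refines_refine (D t) (h t)).trans ih

variable {p : ℕ} [Fact p.Prime]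

theorem exists_chain (hp : 3 ≤ p) {d r : ℕ} (hr : 0 < r) (C : Cells (Gd d))
    {D : ℕ → Cells Circle} {b : ∀ t, (D t).ι → Circle} {η : ℕ → ℝ} (hη : ∀ t, 0 < η t)
    (hD : ∀ t l z, (D t).u l z ≠ 0 → ‖(z : ℂ) - b t l‖ ≤ η t) {Ψ : ZMod p → Gd d}
    (hΨ : IsQMSystem Ψ)
    {f : Fin r → ZMod p → ℝ} (hf₀ : ∀ i x, 0 ≤ f i x) (hf₁ : ∀ i x, f i x ≤ 1) :
    ∃ Φ : ∀ t, ZMod p → Gd (d + 2 * t), Φ 0 = Ψ ∧ (∀ t, IsQMSystem (Φ t)) ∧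
      (∀ t x, forgetTwo _ (Φ (t + 1) x) = Φ t x) ∧
      ∀ t i, qmNorm (fun x => ((f i x - smooth ((stages C D t).pull (Φ t)) (f i) x : ℝ) : ℂ)) ≤
        2 * η t + √((∑ i, cellEnergy ((stages C D (t + 1)).pull (Φ (t + 1))) (f i)) / p
          - (∑ i, cellEnergy ((stages C D t).pull (Φ t)) (f i)) / p) := by
  have step := fun (t : ℕ) (Θ : {Θ : ZMod p → Gd (d + 2 * t) // IsQMSystem Θ}) =>
    exists_extension_qmNorm_le hp hr (stages C D t) (hη t) (hD t) Θ.2 hf₀ hf₁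
  choose next h₁ h₂ h₃ using step
  let Φ : ∀ t, {Θ : ZMod p → Gd (d + 2 * t) // IsQMSystem Θ} := fun t =>
    Nat.rec ⟨Ψ, hΨ⟩ (fun t Θ => ⟨next t Θ, h₁ t Θ⟩) t
  exact ⟨fun t => (Φ t).1, rfl, fun t => (Φ t).2, fun t => h₂ t (Φ t), fun t => h₃ t (Φ t)⟩

end Chains

/-! ### The regularity lemma for integer parameters -/

section Regularity

/-- The fraction `4 / (n + 4)` as an element of `(0, 1]`. -/
def fracI01 (n : ℕ) : I01 := ⟨4 / (n + 4), by positivity, by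
  rw [div_le_one (by positivity)]; linarith [(n.cast_nonneg : (0 : ℝ) ≤ n)]⟩

/-- The cutoff, partitions and stopping time depend only on `Ω, r, d, n, s`, where `n` and `s`
encode `δ` and `ε` up to rounding. -/
theorem exists_regularity_bounds (Ω : ℕ → ℕ → I01 → ℝ≥0 → ℕ → RGeOne) (hΩ : MonotoneGrowth Ω)
    (r d n s : ℕ) :
    ∃ (M : ℝ≥0) (D : ℕ), ∀ (p : ℕ) [Fact p.Prime] (δ ε : I01) (Ψ : ZMod p → Gd d)
        (Bt : Set (ZMod p)) (c : Bt → Fin r),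
        ⌈4 / (δ : ℝ)⌉₊ = n + 4 → ⌈1 / (ε : ℝ)⌉₊ = s + 1 →
        IsQMSystem Ψ →
        Bt ⊆ bohrSet Ψ δ →
        (1 - (ε : ℝ) ^ 2 / 100) * ((bohrSet Ψ δ).ncard : ℝ) ≤ (Bt.ncard : ℝ) →
        3 ≤ p →
        ∃ (d' : ℕ) (Ψ' : ZMod p → Gd d') (F : Fin r → Gd d' → ℝ) (g : Fin r → ZMod p → ℝ),
          IsQMSystem Ψ' ∧ Extends Ψ' Ψ ∧
          (∀ i y, 0 ≤ F i y) ∧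
          (∀ i x, g i x ∈ Set.Icc (-1 : ℝ) 1) ∧
          (∀ i, trigNorm (fun y => (F i y : ℂ)) ≤ M) ∧
          d' ≤ D ∧
          (∀ i, avgNorm 2 (fun x => F i (Ψ' x) - g i x) ≤ ε) ∧
          (∀ i, qmNorm (fun x => (colourClass c i).indicator (fun _ => (1 : ℂ)) x - (g i x : ℂ))
            ≤ 1 / (Ω r d δ (trigNorm (fun y => (F i y : ℂ))).toNNReal d' : ℝ)) ∧
          (∀ x ∈ bohrSet Ψ ((δ : ℝ) / 2), 1 ≤ ∑ i, F i (Ψ' x)) ∧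
          (∀ i, avgNorm 4 (fun x => F i (Ψ' x)) ≤ 2) := by
  -- The ceiling condition gives `n + 3 < 4 / δ ≤ n + 4`, so these two radii lie between `δ / 2` and
  -- `δ` for every admissible `δ`.
  have hab : 2 / ((n : ℝ) + 3) < 4 / ((n : ℝ) + 4) := by
    rw [div_lt_div_iff₀ (by positivity) (by positivity)]
    linarith [(n.cast_nonneg : (0 : ℝ) ≤ n)]
  obtain ⟨W, hW₀, hW₁, hWa, hWb⟩ := exists_cutoff hab d
  set ε₀ : ℝ := 1 / ((s : ℝ) + 1) with hε₀
  have hε₀_pos : 0 < ε₀ := by positivity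
  let C := Cells.ofFun W hW₀ hW₁
  have hη : ∀ t : ℕ, (0 : ℝ) < 1 / ((t : ℝ) + 1) := fun t => by positivity
  choose D b hD using fun t : ℕ => exists_circleCells (hη t)
  choose M hM using fun t : ℕ =>
    (stages C D t).exists_trig_approx (by positivity : 0 < ε₀ / 10)
  have hΩpos : ∀ t, (0 : ℝ) < Ω r d (fracI01 n) (M t) (d + 2 * t) := fun t =>
    one_pos.trans_le (Ω r d (fracI01 n) (M t) (d + 2 * t)).2
  obtain ⟨T, hT⟩ := exists_stable_pair (r : ℝ) (by positivity : 0 < ε₀ ^ 2 / 16)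
    -- Thirds, because the QM bound is `2 * η t'` plus the root of an energy increment. Evaluating
    -- at `fracI01 n ≤ δ` dominates the true value of `Ω`.
    (τ := fun t => 1 / (3 * (Ω r d (fracI01 n) (M t) (d + 2 * t) : ℝ)))
    (fun t => by have := hΩpos t; positivity)
  refine ⟨∑ t ∈ Finset.range (T + 1), M t, d + 2 * T, ?_⟩
  intro p _ δ ε Ψ Bt c hδn hεs hΨ hBt hcard hp
  have hp₀ : (0 : ℝ) < p := by exact_mod_cast (Fact.out : p.Prime).pos
  have hδ := δ.2.1
  have hε := ε.2.1
  have hε₀ε : ε₀ ≤ ε := by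
    have h := Nat.le_ceil (1 / (ε : ℝ))
    rw [hεs] at h
    push_cast at h
    rw [hε₀]
    exact (one_div_le hε (by positivity)).1 h
  have hδ_lower : 4 / ((n : ℝ) + 4) ≤ δ := by
    have h := Nat.le_ceil (4 / (δ : ℝ))
    rw [hδn] at h
    push_cast at h
    rw [div_le_iff₀ hδ] at h
    rw [div_le_iff₀ (by positivity)]
    linarith
  have hδ_upper : (δ : ℝ) / 2 ≤ 2 / ((n : ℝ) + 3) := by
    have h : ((n + 3 : ℕ) : ℝ) < 4 / (δ : ℝ) := Nat.lt_ceil.1 (by omega)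
    push_cast at h
    rw [lt_div_iff₀ hδ] at h
    rw [le_div_iff₀ (by positivity)]
    linarith
  set B := bohrSet Ψ δ
  -- `0 ∈ B` as extended characters equal `1` there, and `Bt` omits at most one percent of `B`, so
  -- some point is coloured.
  have hr : 0 < r := by
    have h0 : (0 : ZMod p) ∈ B := by
      obtain ⟨a, ψ, h⟩ := hΨ
      refine Real.iSup_le (fun i => ?_) hδ.le
      rw [h]
      simp [absG, circleAbs, extChar, hδ.le]
    have hBpos : (0 : ℝ) < B.ncard := by
      exact_mod_cast (Set.ncard_pos (Set.toFinite B)).2 ⟨0, h0⟩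
    have hε1 : (ε : ℝ) ^ 2 ≤ 1 := pow_le_one₀ hε.le ε.2.2
    have hBt_pos : (0 : ℝ) < Bt.ncard :=
      (mul_pos (by linarith) hBpos).trans_le hcard
    obtain ⟨x, hx⟩ := (Set.ncard_pos (Set.toFinite Bt)).1 (by exact_mod_cast hBt_pos)
    exact Fin.pos (c ⟨x, hx⟩)
  let f : Fin r → ZMod p → ℝ := fun i => (colourClass c i).indicator fun _ => 1
  have hf₀ : ∀ i x, 0 ≤ f i x := fun i x => Set.indicator_nonneg (fun _ _ => zero_le_one) x
  have hf₁ : ∀ i x, f i x ≤ 1 := fun i x => Set.indicator_le_self' (fun _ _ => zero_le_one) x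
  let e : ZMod p → ℝ := (B \ Bt).indicator fun _ => 1
  have he₀ : ∀ x, 0 ≤ e x := fun x => Set.indicator_nonneg (fun _ _ => zero_le_one) x
  have hcover : ∀ x ∈ B, 1 ≤ ∑ i, f i x + e x := fun x hx => by
    by_cases hxt : x ∈ Bt
    · have hx' : x ∈ colourClass c (c ⟨x, hxt⟩) := ⟨⟨x, hxt⟩, rfl, rfl⟩
      have h₁ : f (c ⟨x, hxt⟩) x = 1 := Set.indicator_of_mem hx' _
      have h₂ := Finset.single_le_sum (f := fun i => f i x) (fun i _ => hf₀ i x)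
        (Finset.mem_univ (c ⟨x, hxt⟩))
      linarith [he₀ x]
    · have hx' : x ∈ B \ Bt := ⟨hx, hxt⟩
      have h₁ : e x = 1 := Set.indicator_of_mem hx' _
      linarith [Finset.sum_nonneg fun i (_ : i ∈ Finset.univ) => hf₀ i x]
  have he₂ : ∑ x, e x ^ 2 ≤ (ε : ℝ) ^ 2 / 100 * p := by
    rw [sum_indicator_one_sq, Set.cast_ncard_sdiff hBt (Set.toFinite B)]
    have h₁ : (B.ncard : ℝ) ≤ p := by
      have := Set.ncard_le_card B
      rw [Nat.card_zmod] at this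
      exact_mod_cast this
    have h₂ : (ε : ℝ) ^ 2 / 100 * B.ncard ≤ (ε : ℝ) ^ 2 / 100 * p := by gcongr
    linarith
  obtain ⟨Φ, hΦ₀, hΦ, hΦs, hΦq⟩ := exists_chain hp hr C hη hD hΨ hf₀ hf₁
  have hu := fun t => (stages C D t).isPartition_pull (Φ t)
  let E : ℕ → ℝ := fun t => (∑ i, cellEnergy ((stages C D t).pull (Φ t)) (f i)) / p
  obtain ⟨t, t', htt', ht'T, hEκ, hEτ, hητ⟩ := hT E
    (fun t t' h => div_le_div_of_nonneg_right (Finset.sum_le_sum fun i _ =>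
      cellEnergy_mono (hu t) (hu t') (refines_chain C D hΦs h) (f i)) hp₀.le)
    (fun t => div_nonneg (Finset.sum_nonneg fun i _ => cellEnergy_nonneg (hu t) _) hp₀.le)
    (fun t => by
      rw [div_le_iff₀ hp₀]
      calc _ ≤ ∑ i : Fin r, (p : ℝ) := Finset.sum_le_sum fun i _ => by
            refine (cellEnergy_le (hu t) (f i)).trans ?_
            calc ∑ x, f i x ^ 2 ≤ ∑ x : ZMod p, (1 : ℝ) :=
                  Finset.sum_le_sum fun x _ => pow_le_one₀ (hf₀ i x) (hf₁ i x)
              _ = p := by simp [ZMod.card]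
        _ = _ := by simp)
  set u := (stages C D t).pull (Φ t) with hu_def
  have hut := hu t
  -- Each cell at stage `t` descends from `W` or from `1 - W`; those from `W` are supported inside
  -- `B`.
  obtain ⟨π, hπ⟩ : ∃ π : (stages C D t).ι → Bool, ∀ (h : Bool → ℝ) x,
      h true * W (Ψ x) + h false * (1 - W (Ψ x)) = ∑ k, h (π k) * u k x := by
    obtain ⟨π, hπ⟩ := refines_chain C D hΦs (Nat.zero_le t)
    refine ⟨π, fun h x => ?_⟩
    rw [hu_def, ← hπ h x, hΦ₀]
    change _ = ∑ k : Bool, h k * (if k then W else 1 - W) (Ψ x)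
    simp
  let w : (stages C D t).ι → ℝ := fun k => if π k then 1 else 0
  have hw₀ : ∀ k, 0 ≤ w k := fun k => by dsimp only [w]; split_ifs <;> norm_num
  have hw₁ : ∀ k, w k ≤ 1 := fun k => by dsimp only [w]; split_ifs <;> norm_num
  have hwW : ∀ x, W (Ψ x) = ∑ k, w k * u k x := fun x => by
    have h := hπ (fun k => if k then 1 else 0) x
    simpa [w] using h
  have hwB : ∀ k, w k ≤ 0 ∨ ∀ x, u k x ≠ 0 → 1 ≤ ∑ i, f i x + e x := fun k => by
    by_cases hk : π k = true
    · right
      intro x hx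
      refine hcover x (Real.iSup_le (fun i => (hWb _ ?_ i).trans hδ_lower) hδ.le)
      have h₁ := Finset.single_le_sum (f := fun k => w k * u k x)
        (fun k _ => mul_nonneg (hw₀ k) (hut.nonneg k x)) (Finset.mem_univ k)
      have h₂ : w k = 1 := if_pos hk
      have h₃ : 0 < u k x := lt_of_le_of_ne (hut.nonneg k x) (Ne.symm hx)
      simp only [h₂, one_mul, ← hwW] at h₁
      exact (h₃.trans_le h₁).ne'
    · left
      exact (if_neg hk).le
  let v : (stages C D t).ι → ℝ := fun k => max 0 (w k - ∑ i, cellMean u (f i) k)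
  have hv₀ : ∀ k, 0 ≤ v k := fun k => le_max_left _ _
  have hv : ∀ x, ∑ k, v k * u k x ≤ smooth u e x := fun x =>
    Finset.sum_le_sum fun k _ => deficit_mul_le hut he₀ hf₀ (hw₁ k) (hwB k) x
  let a : Fin r → (stages C D t).ι → ℝ := fun i k => cellMean u (f i) k + v k
  have hmean₀ : ∀ i k, 0 ≤ cellMean u (f i) k := fun i => cellMean_nonneg hut (hf₀ i)
  have ha₀ : ∀ i k, 0 ≤ a i k := fun i k => add_nonneg (hmean₀ i k) (hv₀ k)
  -- A positive deficit lifts the total density only to `w k`, so adding all of it to one colour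
  -- stays below `1`.
  have ha₁ : ∀ i k, a i k ≤ 1 := fun i k => by
    have h₁ := Finset.single_le_sum (f := fun i => cellMean u (f i) k) (fun i _ => hmean₀ i k)
      (Finset.mem_univ i)
    have h₂ := cellMean_le_one hut (hf₁ i) k
    rcases max_cases 0 (w k - ∑ i, cellMean u (f i) k) with ⟨h, -⟩ | ⟨h, -⟩ <;>
    · change cellMean u (f i) k + max 0 (w k - ∑ i, cellMean u (f i) k) ≤ 1
      rw [h]
      linarith [hw₁ k]
  choose F hFM hF using fun i => hM t (a i) (ha₀ i) (ha₁ i)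
  have hFl : ∀ i x, ∑ k, a i k * u k x ≤ F i (Φ t x) := fun i x => (hF i (Φ t x)).1
  have hFu : ∀ i x, F i (Φ t x) ≤ ∑ k, a i k * u k x + 2 * (ε₀ / 10) := fun i x =>
    (hF i (Φ t x)).2
  have hF₀ : ∀ i y, 0 ≤ F i y := fun i y =>
    (Finset.sum_nonneg fun k _ => mul_nonneg (ha₀ i k) ((stages C D t).nonneg k y)).trans
      (hF i y).1
  have hg₀ := fun i => smooth_nonneg (hu t') (hf₀ i)
  have hg₁ := fun i => smooth_le_one (hu t') (hf₁ i)
  refine ⟨d + 2 * t, Φ t, F, fun i => smooth ((stages C D t').pull (Φ t')) (f i), hΦ t,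
    hΦ₀ ▸ extends_chain hΦs t, hF₀, fun i x => ⟨by linarith [hg₀ i x], hg₁ i x⟩,
    fun i => (hFM i).trans ?_, by omega, fun i => ?_, fun i => ?_, fun x hx => ?_, fun i => ?_⟩
  · exact_mod_cast Finset.single_le_sum (fun _ _ => zero_le)
      (Finset.mem_range.2 (Nat.lt_succ_of_le (htt'.trans ht'T)))
  · apply avgNorm_le two_ne_zero hε.le
    have h₁ : ∑ x, smooth u e x ^ 2 ≤ (ε : ℝ) ^ 2 / 100 * p :=
      (sum_smooth_sq_le_cellEnergy hut e).trans ((cellEnergy_le hut e).trans he₂)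
    have h₂ : ∑ x, (smooth ((stages C D t').pull (Φ t')) (f i) x - smooth u (f i) x) ^ 2
        ≤ ε₀ ^ 2 / 16 * p := by
      have href := refines_chain C D hΦs htt'
      refine (sum_smooth_sub_sq_le hut (hu t') href (f i)).trans ?_
      have h₃ := Finset.single_le_sum (f := fun i => cellEnergy ((stages C D t').pull (Φ t')) (f i)
        - cellEnergy u (f i))
        (fun j _ => sub_nonneg.2 (cellEnergy_mono hut (hu t') href (f j))) (Finset.mem_univ i)
      refine h₃.trans ?_
      rw [Finset.sum_sub_distrib, ← div_le_iff₀ hp₀, sub_div]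
      exact hEκ
    -- Three errors: trigonometric approximation, correction, and change of averages from `t` to
    -- `t'`. Their mean squares satisfy `3 * (1/25 + 1/100 + 1/16) < 1`, in units of `ε ^ 2`.
    have h₃ : ∀ x, |F i (Φ t x) - smooth ((stages C D t').pull (Φ t')) (f i) x| ^ 2 ≤
        3 * ((ε₀ / 5) ^ 2 + smooth u e x ^ 2
          + (smooth ((stages C D t').pull (Φ t')) (f i) x - smooth u (f i) x) ^ 2) := fun x => by
      have k₁ : ∑ k, a i k * u k x = smooth u (f i) x + ∑ k, v k * u k x := by
        simp only [a, add_mul, Finset.sum_add_distrib]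
        rfl
      have k₂ : 0 ≤ ∑ k, v k * u k x :=
        Finset.sum_nonneg fun k _ => mul_nonneg (hv₀ k) (hut.nonneg k x)
      have k₃ := hFl i x
      have k₄ := hFu i x
      have k₅ : (F i (Φ t x) - ∑ k, a i k * u k x) ^ 2 ≤ (ε₀ / 5) ^ 2 :=
        pow_le_pow_left₀ (by linarith) (by linarith) 2
      have k₆ : (∑ k, v k * u k x) ^ 2 ≤ smooth u e x ^ 2 := pow_le_pow_left₀ k₂ (hv x) 2
      rw [sq_abs]
      set A := F i (Φ t x) - ∑ k, a i k * u k x with hA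
      set V := ∑ k, v k * u k x
      set S := smooth ((stages C D t').pull (Φ t')) (f i) x - smooth u (f i) x with hS
      have k₇ : F i (Φ t x) - smooth ((stages C D t').pull (Φ t')) (f i) x = A + V - S := by
        rw [hA, hS, k₁]; ring
      rw [k₇]
      linarith [sq_nonneg (A - V), sq_nonneg (A + S), sq_nonneg (V + S)]
    refine (Finset.sum_le_sum fun x _ => h₃ x).trans ?_
    rw [← Finset.mul_sum, Finset.sum_add_distrib, Finset.sum_add_distrib, Finset.sum_const,
      Finset.card_univ, ZMod.card, nsmul_eq_mul]
    have h₄ : ε₀ ^ 2 * p ≤ (ε : ℝ) ^ 2 * p := by gcongr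
    have h₅ : 0 ≤ (ε : ℝ) ^ 2 * p := by positivity
    linarith
  · have h₁ : (fun x => (colourClass c i).indicator (fun _ => (1 : ℂ)) x
        - (smooth ((stages C D t').pull (Φ t')) (f i) x : ℂ))
        = fun x => ((f i x - smooth ((stages C D t').pull (Φ t')) (f i) x : ℝ) : ℂ) := by
      funext x
      by_cases hx : x ∈ colourClass c i <;> simp [f, hx]
    rw [h₁]
    refine (hΦq t' i).trans ?_
    have h₂ : √(E (t' + 1) - E t')
        ≤ 1 / (3 * (Ω r d (fracI01 n) (M t) (d + 2 * t) : ℝ)) :=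
      Real.sqrt_le_iff.2 ⟨by have := hΩpos t; positivity, hEτ⟩
    have h₃ : (Ω r d δ (trigNorm (fun y => (F i y : ℂ))).toNNReal (d + 2 * t) : ℝ)
        ≤ Ω r d (fracI01 n) (M t) (d + 2 * t) :=
      hΩ r r d d δ (fracI01 n) _ _ _ _ le_rfl le_rfl hδ_lower
        (ENNReal.toNNReal_mono ENNReal.coe_ne_top (hFM i)) le_rfl
    have h₄ : (0 : ℝ) < Ω r d δ (trigNorm (fun y => (F i y : ℂ))).toNNReal (d + 2 * t) :=
      one_pos.trans_le (Ω r d δ _ _).2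
    calc _ ≤ 2 * (1 / (3 * (Ω r d (fracI01 n) (M t) (d + 2 * t) : ℝ)))
          + 1 / (3 * (Ω r d (fracI01 n) (M t) (d + 2 * t) : ℝ)) :=
          add_le_add (mul_le_mul_of_nonneg_left hητ two_pos.le) h₂
      _ = 1 / (Ω r d (fracI01 n) (M t) (d + 2 * t) : ℝ) := by
          have := (hΩpos t).ne'
          field_simp
          norm_num
      _ ≤ _ := one_div_le_one_div_of_le h₄ h₃
  · have h₁ : W (Ψ x) = 1 := hWa _ fun i => (absG_le_of_absGd_le hx i).trans hδ_upper
    rw [← h₁, hwW]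
    refine le_trans ?_ (Finset.sum_le_sum fun i _ => hFl i x)
    rw [Finset.sum_comm]
    refine Finset.sum_le_sum fun k _ => ?_
    rw [← Finset.sum_mul]
    refine mul_le_mul_of_nonneg_right ?_ (hut.nonneg k x)
    simp only [a, Finset.sum_add_distrib, Finset.sum_const, Finset.card_univ, Fintype.card_fin,
      nsmul_eq_mul]
    -- Every colour receives the full correction, so one copy of it already suffices.
    have h₂ : (1 : ℝ) ≤ r := by exact_mod_cast hr
    have h₃ : w k - ∑ i, cellMean u (f i) k ≤ v k := le_max_right _ _
    linarith [le_mul_of_one_le_left (hv₀ k) h₂]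
  · apply avgNorm_le four_ne_zero two_pos.le
    calc ∑ x, |F i (Φ t x)| ^ 4 ≤ ∑ x : ZMod p, (2 : ℝ) ^ 4 := by
          refine Finset.sum_le_sum fun x _ => pow_le_pow_left₀ (abs_nonneg _) ?_ 4
          rw [abs_of_nonneg (hF₀ i _)]
          have h₁ : ∑ k, a i k * u k x ≤ 1 := by
            exact (Finset.sum_le_sum fun k _ => mul_le_of_le_one_left (hut.nonneg k x)
              (ha₁ i k)).trans_eq (hut.sum_one x)
          linarith [hFu i x, hε₀ε.trans ε.2.2]
      _ = _ := by simp [ZMod.card, mul_comm]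

/-! ### Making the bounds monotone -/

/-- The sum of the values of `f` at all tuples bounded by the given one. -/
def boxSum {β : Type*} [AddCommMonoid β] (f : ℕ → ℕ → ℕ → ℕ → β) (r d n s : ℕ) : β :=
  ∑ k ∈ Finset.Iic r ×ˢ Finset.Iic d ×ˢ Finset.Iic n ×ˢ Finset.Iic s, f k.1 k.2.1 k.2.2.1 k.2.2.2

theorem boxSum_mono {β : Type*} [AddCommMonoid β] [PartialOrder β] [IsOrderedAddMonoid β]
    [CanonicallyOrderedAdd β] (f : ℕ → ℕ → ℕ → ℕ → β) {r r' d d' n n' s s' : ℕ} (hr : r ≤ r')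
    (hd : d ≤ d') (hn : n ≤ n') (hs : s ≤ s') : boxSum f r d n s ≤ boxSum f r' d' n' s' := by
  refine Finset.sum_le_sum_of_subset ?_
  gcongr

theorem le_boxSum {β : Type*} [AddCommMonoid β] [PartialOrder β] [IsOrderedAddMonoid β]
    [CanonicallyOrderedAdd β] (f : ℕ → ℕ → ℕ → ℕ → β) (r d n s : ℕ) :
    f r d n s ≤ boxSum f r d n s :=
  Finset.single_le_sum (f := fun k : ℕ × ℕ × ℕ × ℕ => f k.1 k.2.1 k.2.2.1 k.2.2.2)
    (fun _ _ => zero_le)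
    (Finset.mem_product.2 ⟨Finset.mem_Iic.2 le_rfl, Finset.mem_product.2 ⟨Finset.mem_Iic.2 le_rfl,
      Finset.mem_product.2 ⟨Finset.mem_Iic.2 le_rfl, Finset.mem_Iic.2 le_rfl⟩⟩⟩ :
      (r, d, n, s) ∈ _)

theorem ceil_div_anti {c : ℝ} (hc : 0 ≤ c) {δ₁ δ₂ : I01} (h : δ₂ ≤ δ₁) :
    ⌈c / (δ₁ : ℝ)⌉₊ ≤ ⌈c / (δ₂ : ℝ)⌉₊ :=
  Nat.ceil_mono (div_le_div_of_nonneg_left hc δ₂.2.1 h)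

theorem le_ceil_div (c : ℕ) (δ : I01) : c ≤ ⌈(c : ℝ) / δ⌉₊ := by
  have h : (c : ℝ) ≤ c / δ := (le_div_iff₀ δ.2.1).2 (mul_le_of_le_one_right c.cast_nonneg δ.2.2)
  exact_mod_cast h.trans (Nat.le_ceil _)

end Regularity

end
end QM

theorem mainTheorem4 (Ω : ℕ → ℕ → QM.I01 → ℝ≥0 → ℕ → QM.RGeOne) (hΩ : QM.MonotoneGrowth Ω) :
    ∃ (MΩ : ℕ → ℕ → QM.I01 → QM.I01 → QM.RGeOne)
      (DΩ : ℕ → ℕ → QM.I01 → QM.I01 → ℕ)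
      (pΩ : ℕ → ℕ → QM.I01 → QM.I01 → ℕ+),
      QM.MonotoneParam MΩ ∧ QM.MonotoneParam DΩ ∧ QM.MonotoneParam pΩ ∧
      ∀ (p : ℕ) [Fact p.Prime] (r d : ℕ) (δ ε : QM.I01)
        (Ψ : ZMod p → QM.Gd d) (Bt : Set (ZMod p)) (c : Bt → Fin r),
        QM.IsQMSystem Ψ →
        Bt ⊆ QM.bohrSet Ψ δ →
        (1 - (ε : ℝ) ^ 2 / 100) * ((QM.bohrSet Ψ δ).ncard : ℝ) ≤ (Bt.ncard : ℝ) →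
        (pΩ r d δ ε : ℕ) ≤ p →
        ∃ (d' : ℕ) (Ψ' : ZMod p → QM.Gd d') (F : Fin r → QM.Gd d' → ℝ) (g : Fin r → ZMod p → ℝ),
          QM.IsQMSystem Ψ' ∧ QM.Extends Ψ' Ψ ∧
          (∀ i y, 0 ≤ F i y) ∧
          (∀ i x, g i x ∈ Set.Icc (-1 : ℝ) 1) ∧
          (∀ i, QM.trigNorm (fun y => (F i y : ℂ)) ≤ ENNReal.ofReal (MΩ r d δ ε)) ∧
          d' ≤ DΩ r d δ ε ∧
          (∀ i, QM.avgNorm 2 (fun x => F i (Ψ' x) - g i x) ≤ ε) ∧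
          (∀ i, QM.qmNorm (fun x => (QM.colourClass c i).indicator (fun _ => (1 : ℂ)) x - (g i x : ℂ))
            ≤ 1 / (Ω r d δ (QM.trigNorm (fun y => (F i y : ℂ))).toNNReal d' : ℝ)) ∧
          (∀ x ∈ QM.bohrSet Ψ ((δ : ℝ) / 2), 1 ≤ ∑ i, F i (Ψ' x)) ∧
          (∀ i, QM.avgNorm 4 (fun x => F i (Ψ' x)) ≤ 2) := by
  choose M D h using QM.exists_regularity_bounds Ω hΩ
  -- The ceilings are at least `4` and `1`, so the truncated subtractions are exact.
  let n : QM.I01 → ℕ := fun δ => ⌈4 / (δ : ℝ)⌉₊ - 4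
  let s : QM.I01 → ℕ := fun ε => ⌈1 / (ε : ℝ)⌉₊ - 1
  have hn : ∀ {δ₁ δ₂ : QM.I01}, δ₂ ≤ δ₁ → n δ₁ ≤ n δ₂ := fun h =>
    Nat.sub_le_sub_right (QM.ceil_div_anti (by norm_num) h) 4
  have hs : ∀ {ε₁ ε₂ : QM.I01}, ε₂ ≤ ε₁ → s ε₁ ≤ s ε₂ := fun h =>
    Nat.sub_le_sub_right (QM.ceil_div_anti (by norm_num) h) 1
  -- Box sums are monotone majorants; the added `1` puts the bound in `RGeOne`, and only oddness of
  -- `p` is needed, hence the constant `3`.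
  refine ⟨fun r d δ ε => ⟨1 + (QM.boxSum M r d (n δ) (s ε) : ℝ≥0), ?_⟩,
    fun r d δ ε => QM.boxSum D r d (n δ) (s ε), fun _ _ _ _ => 3, ?_, ?_, ?_, ?_⟩
  · exact le_add_of_nonneg_right (NNReal.coe_nonneg _)
  · intro r₁ r₂ d₁ d₂ δ₁ δ₂ ε₁ ε₂ hr hd hδ hε
    have := QM.boxSum_mono M hr hd (hn hδ) (hs hε)
    exact add_le_add_right (NNReal.coe_le_coe.2 this) 1
  · intro r₁ r₂ d₁ d₂ δ₁ δ₂ ε₁ ε₂ hr hd hδ hε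
    exact QM.boxSum_mono D hr hd (hn hδ) (hs hε)
  · intro r₁ r₂ d₁ d₂ δ₁ δ₂ ε₁ ε₂ _ _ _ _
    exact le_rfl
  · intro p _ r d δ ε Ψ Bt c hΨ hBt hcard hp
    have h4 : 4 ≤ ⌈4 / (δ : ℝ)⌉₊ := by exact_mod_cast QM.le_ceil_div 4 δ
    have h1 : 1 ≤ ⌈1 / (ε : ℝ)⌉₊ := by exact_mod_cast QM.le_ceil_div 1 ε
    obtain ⟨d', Ψ', F, g, k₁, k₂, k₃, k₄, k₅, k₆, k₇⟩ := h r d (n δ) (s ε) p δ ε Ψ Bt c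
      (Nat.sub_add_cancel h4).symm (Nat.sub_add_cancel h1).symm hΨ hBt hcard hp
    refine ⟨d', Ψ', F, g, k₁, k₂, k₃, k₄, fun i => (k₅ i).trans ?_,
      k₆.trans (QM.le_boxSum D _ _ _ _), k₇⟩
    rw [← ENNReal.ofReal_coe_nnreal]
    apply ENNReal.ofReal_le_ofReal
    have := NNReal.coe_le_coe.2 (QM.le_boxSum M r d (n δ) (s ε))
    exact this.trans (le_add_of_nonneg_left zero_le_one)
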